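/- Let $k$ be a field and let $r\ge 2$, $g\ge 2$, $n\ge 0$ be integers such that $d=\frac{2g-2+2r}{r(r-1)}$ is an integer; assume that the characteristic of $k$ does not divide $2rd$, and that $n\le rd+1$. Put $N=rd$. Let $\mathbb{A}(N)=\operatorname{Spec} k[a_0,\dots,a_N]$ be the space of binary forms $f(x,y)=\sum_{i=0}^{N}a_ix^{N-i}y^i$ of degree $N$, let $\Phi_{r,g,0}\in k[a_0,\dots,a_N]$ be the discriminant of the generic binary form (homogeneous of degree $2(N-1)$), and let $\Delta_{r,g,0}\subset\mathbb{A}(N)$ be the hypersurface $\Phi_{r,g,0}=0$. Define a $k$-scheme $\mathbb{A}_{r,n}$ with coordinate ring $R_n$ as follows: $R_0=k[a_0,\dots,a_N]$, $R_1=k[a_0,\dots,a_{N-1},s_1]$, $R_2=k[a_1,\dots,a_{N-1},s_1,s_2]$, and for $n\ge 3$ $$R_n=k[a_1,\dots,a_{N+1-n},p_1,\dots,p_{n-3},s_1,s_2,s_3,t_1,\dots,t_{n-3}]\Big[\Big(\prod_{j}p_j(p_j-1)\prod_{i<j}(p_j-p_i)\Big)^{-1}\Big].$$ Over $\mathbb{A}_{r,n}$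 there is a unique binary form $f$ of degree $N$ whose coefficients $a_i$, for those $i$ for which $a_i$ is one of the coordinates of $\mathbb{A}_{r,n}$, are these coordinates, and which satisfies the first $n$ of the relations $$f(0,1)=s_1^r,\quad f(1,0)=s_2^r,\quad f(1,1)=s_3^r,\quad f(1,p_1)=t_1^r,\ \dots,\ f(1,p_{n-3})=t_{n-3}^r.$$ For $n\ge3$ its coefficients are $(s_2^r,a_1,\dots,a_{N+1-n},\varphi^{(n)}_{n-3},\dots,\varphi^{(n)}_{0},s_1^r)$, where the $\varphi^{(n)}_i\in R_n$ are obtained by solving the last $n-2$ relations, which are a linear system with invertible determinant; for $n=1$ they are $(a_0,\dots,a_{N-1},s_1^r)$ and for $n=2$ they are $(s_2^r,a_1,\dots,a_{N-1},s_1^r)$. Let $\Phi_{r,g,n}\in R_n$ be the result of substituting the coefficients of $f$ in $\Phi_{r,g,0}$, and let $\Delta_{r,g,n}\subset\mathbb{A}_{r,n}$ be the scheme-theoretic inverse image of $\Delta_{r,g,0}$ under the morphism $\mathbb{A}_{r,n}\to\mathbb{A}(N)$ given by $f$, that is, the closed subscheme $\Phi_{r,g,n}=0$. Then $\Delta_{r,g,n}$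 is an integral scheme; equivalently, $\Phi_{r,g,n}$ is an irreducible element of $R_n$. -/

import Mathlib

noncomputable section

open CategoryTheory CategoryTheory.Limits AlgebraicGeometry

namespace CyclicCovers

/-- The discriminant of the generic binary form `∑ aᵢ x^(N-i) y^i` of degree `N`, as a polynomial in
its coefficients `a₀, …, a_N`: the discriminant of the generic polynomial `∑ aᵢ Y^i`, whose leading
coefficient is the variable `a_N`. -/
def binaryDiscr (k : Type*) [Field k] (N : ℕ) : MvPolynomial (Fin (N + 1)) k :=
  Polynomial.discr (∑ i : Fin (N + 1),
    Polynomial.C (MvPolynomial.X i : MvPolynomial (Fin (N + 1)) k) * Polynomial.X ^ (i : ℕ))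

/-- The indices `i` for which `aᵢ` is a coordinate of the space `𝔸_{r,n}`:
`0 ≤ i ≤ N` for `n = 0`, `0 ≤ i ≤ N - 1` for `n = 1`, `1 ≤ i ≤ N + 1 - n` for `n ≥ 2`. -/
def IsFree (N n i : ℕ) : Prop :=
  i ≤ N ∧ (1 ≤ n → i < N) ∧ (2 ≤ n → 1 ≤ i ∧ i + n ≤ N + 1)

/-- The coordinates of `𝔸_{r,n}`: the free coefficients `aᵢ`, the positions `p₁, …, p_{n-3}`
(`p j` is `p_{j+1}`), and `s₁, s₂, s₃, t₁, …, t_{n-3}` (`s 0, s 1, s 2` are `s₁, s₂, s₃` and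
`s (2 + j)` is `t_j` for `j ≥ 1`). -/
inductive Coord (N n : ℕ) : Type
  | a (i : {i : ℕ // IsFree N n i}) : Coord N n
  | p (j : Fin (n - 3)) : Coord N n
  | s (j : Fin n) : Coord N n

/-- The equation of the locus to be removed: some `p_j` is `0` or `1`, or two of them coincide. -/
def badLocus (k : Type*) [Field k] (N n : ℕ) : MvPolynomial (Coord N n) k :=
  (∏ j : Fin (n - 3), MvPolynomial.X (Coord.p j) * (MvPolynomial.X (Coord.p j) - 1)) *
    ∏ i : Fin (n - 3), ∏ j ∈ Finset.Ioi i,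
      (MvPolynomial.X (Coord.p j) - MvPolynomial.X (Coord.p i))

/-- The coordinate ring of `𝔸_{r,n} = 𝔸^{N+1-n} × (𝔸^{n-3} ∖ Δ̃) × 𝔸^n` for `n ≥ 3`, and of the
affine space `𝔸^{N+1}` for `n ≤ 3` (then `badLocus` is `1`). -/
abbrev CoordRing (k : Type*) [Field k] (N n : ℕ) : Type _ :=
  Localization.Away (badLocus k N n)

/-- A coordinate, as a function on `𝔸_{r,n}`. -/
def coordFun (k : Type*) [Field k] (N n : ℕ) (c : Coord N n) : CoordRing k N n :=
  algebraMap (MvPolynomial (Coord N n) k) (CoordRing k N n) (MvPolynomial.X c)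

/-- The functions `s₁, s₂, s₃, t₁, …, t_{n-3}` (numbered from `0`). -/
def sec (k : Type*) [Field k] (N n j : ℕ) : CoordRing k N n :=
  if h : j < n then coordFun k N n (Coord.s ⟨j, h⟩) else 0

/-- The points `1, p₁, …, p_{n-3}`, i.e. the affine coordinates of the sections number
`3, …, n`. -/
def node (k : Type*) [Field k] (N n : ℕ) (j : Fin (n - 2)) : CoordRing k N n :=
  if h : (j : ℕ) = 0 then 1
  else coordFun k N n (Coord.p ⟨(j : ℕ) - 1, by have := j.2; omega⟩)

open Classical in
/-- The coefficients of the form which are known at once: the free ones, `a_N = s₁^r` (if `n ≥ 1`),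
`a₀ = s₂^r` (if `n ≥ 2`). The unknown ones, which are those with index in `{N + 2 - n, …, N - 1}`
(only if `n ≥ 3`), are replaced by `0`. -/
def knownCoeff (k : Type*) [Field k] (r N n i : ℕ) : CoordRing k N n :=
  if h : IsFree N n i then coordFun k N n (Coord.a ⟨i, h⟩)
  else if i = N then sec k N n 0 ^ r
  else if i = 0 then sec k N n 1 ^ r
  else 0

/-- The matrix of the linear system that expresses the relations `f(1, 1) = s₃^r`,
`f(1, p_j) = t_j^r` in terms of the unknown coefficients of `f`, those of index
`N + 2 - n + l` with `0 ≤ l < n - 2`. -/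
def systemMatrix (k : Type*) [Field k] (N n : ℕ) :
    Matrix (Fin (n - 2)) (Fin (n - 2)) (CoordRing k N n) :=
  Matrix.of fun j l => node k N n j ^ (N + 2 - n + (l : ℕ))

/-- The right-hand side of that linear system. -/
def systemRhs (k : Type*) [Field k] (r N n : ℕ) (j : Fin (n - 2)) : CoordRing k N n :=
  sec k N n ((j : ℕ) + 2) ^ r -
    ∑ i ∈ Finset.range (N + 1), knownCoeff k r N n i * node k N n j ^ i

/-- The solution of the linear system (its determinant is a unit, see `isUnit_det_systemMatrix`):
`solCoeff l` is the coefficient of index `N + 2 - n + l`, i.e. the function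
`φ^{(n)}_{n-3-l}`. -/
def solCoeff (k : Type*) [Field k] (r N n : ℕ) : Fin (n - 2) → CoordRing k N n :=
  (systemMatrix k N n)⁻¹.mulVec (systemRhs k r N n)

/-- The coefficients of the form `f` over `𝔸_{r,n}`, of degree `N`, determined by the coordinates:
`(a₀, …, a_N)` for `n = 0`, `(a₀, …, a_{N-1}, s₁^r)` for `n = 1`,
`(s₂^r, a₁, …, a_{N-1}, s₁^r)` for `n = 2`, and
`(s₂^r, a₁, …, a_{N+1-n}, φ^{(n)}_{n-3}, …, φ^{(n)}_0, s₁^r)` for `n ≥ 3`. -/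
def formCoeff (k : Type*) [Field k] (r N n : ℕ) (i : Fin (N + 1)) : CoordRing k N n :=
  if h : N + 2 - n ≤ (i : ℕ) ∧ (i : ℕ) - (N + 2 - n) < n - 2 then
    solCoeff k r N n ⟨(i : ℕ) - (N + 2 - n), h.2⟩
  else knownCoeff k r N n i

/-- Functions on the space `𝔸(N)` of forms of degree `N`, pulled back to `𝔸_{r,n}` along the map
that sends a point to its associated form and forgets everything else. -/
def pullFun (k : Type*) [Field k] (r N n : ℕ) :
    MvPolynomial (Fin (N + 1)) k →+* CoordRing k N n :=
  (MvPolynomial.aeval (formCoeff k r N n)).toRingHom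

/-- The polynomial `Φ_{r,g,n}`, with `N = rd`: the discriminant with the coefficients of the form
over `𝔸_{r,n}` substituted. -/
def Phi (k : Type*) [Field k] (r N n : ℕ) : CoordRing k N n :=
  pullFun k r N n (binaryDiscr k N)

/-- The map `𝔸_{r,n} ⟶ 𝔸(N)` to the space of forms. -/
def toForms (k : Type*) [Field k] (r N n : ℕ) :
    Spec (CommRingCat.of (CoordRing k N n)) ⟶
      Spec (CommRingCat.of (MvPolynomial (Fin (N + 1)) k)) :=
  Spec.map (CommRingCat.ofHom (pullFun k r N n))

/-- The closed immersion of the discriminant hypersurface into `𝔸(N)`. -/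
def discrImmersion (k : Type*) [Field k] (N : ℕ) :
    Spec (CommRingCat.of (MvPolynomial (Fin (N + 1)) k ⧸ Ideal.span {binaryDiscr k N})) ⟶
      Spec (CommRingCat.of (MvPolynomial (Fin (N + 1)) k)) :=
  Spec.map (CommRingCat.ofHom (Ideal.Quotient.mk (Ideal.span {binaryDiscr k N})))

/-- The closed subscheme `Δ_{r,g,n}` of `𝔸_{r,n}`, with `N = rd`: the scheme-theoretic inverse
image of the discriminant hypersurface. -/
def Delta (k : Type*) [Field k] (r N n : ℕ) : Scheme :=
  pullback (toForms k r N n) (discrImmersion k N)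

theorem isUnit_badLocus (k : Type*) [Field k] (N n : ℕ) :
    IsUnit (algebraMap (MvPolynomial (Coord N n) k) (CoordRing k N n) (badLocus k N n)) :=
  IsLocalization.Away.algebraMap_isUnit _

theorem isUnit_node (k : Type*) [Field k] (N n : ℕ) (j : Fin (n - 2)) :
    IsUnit (node k N n j) := by
  unfold node
  split_ifs with h
  · exact isUnit_one
  · refine isUnit_of_dvd_unit (map_dvd _ ?_) (isUnit_badLocus k N n)
    refine Dvd.dvd.mul_right ?_ _
    exact (Dvd.intro _ rfl).trans (Finset.dvd_prod_of_mem _ (Finset.mem_univ _))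

theorem isUnit_node_sub (k : Type*) [Field k] (N n : ℕ) (i j : Fin (n - 2)) (hij : i < j) :
    IsUnit (node k N n j - node k N n i) := by
  have hj : (j : ℕ) ≠ 0 := by have : (i : ℕ) < j := hij; omega
  unfold node
  rw [dif_neg hj]
  split_ifs with h
  · unfold coordFun
    rw [← map_one (algebraMap (MvPolynomial (Coord N n) k) (CoordRing k N n)), ← map_sub]
    refine isUnit_of_dvd_unit (map_dvd _ ?_) (isUnit_badLocus k N n)
    refine Dvd.dvd.mul_right ?_ _
    exact (Dvd.intro_left _ rfl).trans (Finset.dvd_prod_of_mem _ (Finset.mem_univ _))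
  · unfold coordFun
    rw [← map_sub]
    refine isUnit_of_dvd_unit (map_dvd _ ?_) (isUnit_badLocus k N n)
    refine Dvd.dvd.mul_left ?_ _
    refine Dvd.dvd.trans ?_ (Finset.dvd_prod_of_mem _
      (Finset.mem_univ (⟨(i : ℕ) - 1, by have := i.2; omega⟩ : Fin (n - 3))))
    refine Finset.dvd_prod_of_mem (fun j' : Fin (n - 3) =>
      (MvPolynomial.X (Coord.p j') - MvPolynomial.X (Coord.p _) : MvPolynomial (Coord N n) k)) ?_
    rw [Finset.mem_Ioi, Fin.lt_def]
    have : (i : ℕ) < j := hij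
    simp only
    omega

theorem isUnit_det_systemMatrix (k : Type*) [Field k] (N n : ℕ) :
    IsUnit (systemMatrix k N n).det := by
  have h : systemMatrix k N n = Matrix.of fun j l =>
      (fun j => node k N n j ^ (N + 2 - n)) j * Matrix.vandermonde (node k N n) j l := by
    ext j l
    simp [systemMatrix, Matrix.vandermonde_apply, pow_add]
  rw [h, Matrix.det_mul_column, Matrix.det_vandermonde]
  refine IsUnit.mul ?_ ?_
  · exact IsUnit.prod_univ_iff.2 fun j => (isUnit_node k N n j).pow _
  · refine IsUnit.prod_univ_iff.2 fun i => ?_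
    refine IsUnit.prod_iff.2 fun j hj => ?_
    exact isUnit_node_sub k N n i j (Finset.mem_Ioi.1 hj)

/-- The form over `𝔸_{r,n}` satisfies the relations `f(1, 1) = s₃^r`, `f(1, p_j) = t_j^r`. -/
theorem sum_formCoeff (k : Type*) [Field k] (r N n : ℕ) (hn : n ≤ N + 1) (j : Fin (n - 2)) :
    ∑ i : Fin (N + 1), formCoeff k r N n i * node k N n j ^ (i : ℕ) =
      sec k N n ((j : ℕ) + 2) ^ r := by
  have hn3 : 3 ≤ n := by have := j.2; omega
  have key : (systemMatrix k N n).mulVec (solCoeff k r N n) = systemRhs k r N n := by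
    unfold solCoeff
    rw [Matrix.mulVec_mulVec, Matrix.mul_nonsing_inv _ (isUnit_det_systemMatrix k N n),
      Matrix.one_mulVec]
  have hj := congrFun key j
  have hsplit : ∀ i : Fin (N + 1), formCoeff k r N n i * node k N n j ^ (i : ℕ) =
      knownCoeff k r N n i * node k N n j ^ (i : ℕ) +
        ∑ l : Fin (n - 2), if (i : ℕ) = N + 2 - n + (l : ℕ) then
          solCoeff k r N n l * node k N n j ^ (N + 2 - n + (l : ℕ)) else 0 := by
    intro i
    unfold formCoeff
    split_ifs with h
    · have hk : knownCoeff k r N n i = 0 := by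
        unfold knownCoeff
        rw [dif_neg (fun hf => by have := (hf.2.2 (by omega)).2; omega),
          if_neg (by omega), if_neg (by omega)]
      rw [hk, zero_mul, zero_add, Finset.sum_eq_single ⟨(i : ℕ) - (N + 2 - n), h.2⟩]
      · have hi : N + 2 - n + ((i : ℕ) - (N + 2 - n)) = i := by omega
        simp only [hi, if_true]
      · intro l _ hl
        rw [if_neg]
        intro hi
        exact hl (Fin.ext (by simp only; omega))
      · intro hi
        exact absurd (Finset.mem_univ _) hi
    · rw [Finset.sum_eq_zero, add_zero]
      intro l _
      rw [if_neg]
      intro hi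
      exact h ⟨by omega, by have := l.2; omega⟩
  simp only [Matrix.mulVec, dotProduct, systemMatrix, Matrix.of_apply, systemRhs] at hj
  rw [Finset.sum_congr rfl fun i _ => hsplit i, Finset.sum_add_distrib, Finset.sum_comm,
    Fin.sum_univ_eq_sum_range (fun i => knownCoeff k r N n i * node k N n j ^ i) (N + 1),
    ← eq_sub_iff_add_eq', ← hj]
  refine Finset.sum_congr rfl fun l _ => ?_
  rw [Finset.sum_eq_single (⟨N + 2 - n + (l : ℕ), by have := l.2; omega⟩ : Fin (N + 1))]
  · simp only [if_true]
    exact mul_comm _ _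
  · intro i _ hi
    rw [if_neg]
    intro h
    exact hi (Fin.ext h)
  · intro h
    exact absurd (Finset.mem_univ _) h

/-- The form over `𝔸_{r,n}` satisfies the relation `f(0, 1) = s₁^r`, if `n ≥ 1`. -/
theorem formCoeff_last (k : Type*) [Field k] (r N n : ℕ) (h1 : 1 ≤ n) (hn : n ≤ N + 1) :
    formCoeff k r N n (Fin.last N) = sec k N n 0 ^ r := by
  unfold formCoeff knownCoeff
  rw [dif_neg (by simp only [Fin.val_last]; omega),
    dif_neg (fun hf => by have := hf.2.1 h1; simp only [Fin.val_last] at this; omega),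
    if_pos (Fin.val_last N)]

/-- The form over `𝔸_{r,n}` satisfies the relation `f(1, 0) = s₂^r`, if `n ≥ 2`. -/
theorem formCoeff_zero (k : Type*) [Field k] (r N n : ℕ) (h2 : 2 ≤ n)
    (hn : n ≤ N + 1) : formCoeff k r N n 0 = sec k N n 1 ^ r := by
  unfold formCoeff knownCoeff
  rw [dif_neg (by simp only [Fin.val_zero]; omega),
    dif_neg (fun hf => by have := (hf.2.2 h2).1; simp only [Fin.val_zero] at this; omega),
    if_neg (by simp only [Fin.val_zero]; omega), if_pos (by simp only [Fin.val_zero])]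

/-- The free coefficients of the form over `𝔸_{r,n}` are the coordinates `aᵢ`. -/
theorem formCoeff_free (k : Type*) [Field k] (r N n : ℕ) (hn : n ≤ N + 1) (i : Fin (N + 1))
    (h : IsFree N n i) : formCoeff k r N n i = coordFun k N n (Coord.a ⟨i, h⟩) := by
  unfold formCoeff knownCoeff
  rw [dif_neg (fun hf => by have := (h.2.2 (by omega)).2; omega), dif_pos h]

end CyclicCovers

end

noncomputable section

open CategoryTheory CategoryTheory.Limits AlgebraicGeometry

namespace CyclicCovers


/-! Primality of `Phi` is obtained by exhibiting its principal ideal as the kernel of a homomorphism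
ψ from the coordinate ring to a field, that is, by constructing a generic point of the discriminant
locus (`exists_forall_eq_zero_iff_Phi_dvd`).

Let F be an algebraically closed field containing k[p₁, …, p_{n-3}], and let K be the fraction field
of F[c][x₁, …, x_N]. Over K there is the generic form with a double root, c ∏ (Y - xᵢ) with one root
replaced by another. Since r is invertible, its values at the points ∞, 0, 1, pⱼ have r-th roots in
a separable closure E of K. Taking these roots as the sⱼ gives an E-valued point of 𝔸_{r,n}
(`exists_specialization`), and `Phi` vanishes there because of the double root.

Conversely, suppose z vanishes at this point. Up to a unit, z is a sum of monomials in the sⱼ with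
exponents below r, with coefficients G_e polynomial in the aᵢ and pⱼ (`exists_sum_coeffHom`). The
values of the form at distinct points are multiplicatively independent modulo r-th powers: the
valuation at x - a, for a simple root x, sees only the value at a, and the valuation at c then
handles ∞. A third root is needed here, hence N ≥ 3. By Kummer theory the monomials are linearly
independent over K, so each G_e vanishes on the generic form with a double root.

Finally, the discriminant divides every such G_e (`binaryDiscr_dvd`). In terms of the roots, G_e is
symmetric and vanishes on a diagonal, so in characteristic other than 2 it is divisible by the
square of the product of differences, with symmetric quotient. The quotient is polynomial in the
coefficients up to a power of a_N, and that power cancels because a_N does not divide the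
discriminant. -/

/-! ### Kummer theory. -/

/-- Kummer theory: if the ground field contains the `r`-th roots of unity, and monomials of
exponents `< r` in the `r`-th roots `s i` are pairwise non-proportional, then they are linearly
independent. -/
theorem linearIndependent_kummer_monomials {K E ι : Type*} [Field K] [Field E] [Algebra K E]
    [IsGalois K E] [Fintype ι] {r : ℕ}
    (hμ : ∀ ω : E, ω ^ r = 1 → ω ∈ Set.range (algebraMap K E)) (s : ι → E)
    (hs : ∀ i, s i ≠ 0) (hsr : ∀ i, s i ^ r ∈ Set.range (algebraMap K E))
    (hind : ∀ (e e' : ι → Fin r) (x : K),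
      ∏ i, s i ^ (e i : ℕ) = algebraMap K E x * ∏ i, s i ^ (e' i : ℕ) → e = e') :
    LinearIndependent K (fun e : ι → Fin r => ∏ i, s i ^ (e i : ℕ)) := by
  classical
  set m : (ι → Fin r) → E := fun e => ∏ i, s i ^ (e i : ℕ) with hm
  have hm0 : ∀ e, m e ≠ 0 := fun e => Finset.prod_ne_zero_iff.2 fun i _ => pow_ne_zero _ (hs i)
  have hmr : ∀ e, m e ^ r ∈ Set.range (algebraMap K E) := by
    intro e
    choose b hb using hsr
    refine ⟨∏ i, b i ^ (e i : ℕ), ?_⟩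
    simp only [hm, map_prod, map_pow, hb, ← Finset.prod_pow]
    exact Finset.prod_congr rfl fun i _ => by rw [← pow_mul, ← pow_mul, mul_comm]
  have hω : ∀ e (σ : Gal(E/K)), σ (m e) / m e ∈ Set.range (algebraMap K E) := by
    intro e σ
    apply hμ
    obtain ⟨y, hy⟩ := hmr e
    rw [div_pow, ← map_pow, ← hy, AlgEquiv.commutes, hy, div_self (pow_ne_zero _ (hm0 e))]
  -- The cocycle σ ↦ σ(m)/m is a character because its values are r-th roots of unity, which lie in
  -- K and are fixed by the Galois group.
  let χ : (ι → Fin r) → (Gal(E/K) →* E) := fun e =>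
    { toFun := fun σ => σ (m e) / m e
      map_one' := by simp [hm0 e]
      map_mul' := by
        intro σ τ
        obtain ⟨y, hy⟩ := hω e τ
        have h1 : τ (m e) = algebraMap K E y * m e := by rw [hy, div_mul_cancel₀ _ (hm0 e)]
        rw [AlgEquiv.mul_apply, h1, map_mul, AlgEquiv.commutes, mul_div_cancel_right₀ _ (hm0 e),
          mul_div_assoc, mul_comm] }
  -- If two characters agree, the quotient of the monomials is Galois invariant, hence in K, which
  -- `hind` allows only for equal exponents.
  have hχ : Function.Injective χ := by
    intro e e' h
    have h2 : m e / m e' ∈ Set.range (algebraMap K E) := by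
      rw [InfiniteGalois.mem_range_algebraMap_iff_fixed]
      intro σ
      have h3 : σ (m e) / m e = σ (m e') / m e' := DFunLike.congr_fun h σ
      have : σ (m e') ≠ 0 := by simpa using hm0 e'
      rw [map_div₀]
      rw [div_eq_div_iff (hm0 _) (hm0 _)] at h3
      rw [div_eq_div_iff this (hm0 _), h3, mul_comm]
    obtain ⟨x, hx⟩ := h2
    exact hind e e' x (by rw [hx, div_mul_cancel₀ _ (hm0 e')])
  have hli := (linearIndependent_monoidHom (Gal(E/K)) E).comp χ hχ
  rw [Fintype.linearIndependent_iff] at hli ⊢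
  intro c hc e
  -- Applying all σ to a relation ∑ c_e m_e = 0 turns it into a relation among the characters with
  -- coefficients c_e m_e, to which Dedekind's independence applies.
  have := hli (fun e => algebraMap K E (c e) * m e) (by
    funext σ
    have h4 := congrArg σ hc
    simp only [map_sum, map_zero, Algebra.smul_def, map_mul, AlgEquiv.commutes] at h4
    simp only [Finset.sum_apply, Pi.smul_apply, Function.comp_apply, smul_eq_mul, Pi.zero_apply]
    rw [← h4]
    refine Finset.sum_congr rfl fun e _ => ?_
    change algebraMap K E (c e) * m e * (σ (m e) / m e) = _
    rw [mul_assoc, mul_div_cancel₀ _ (hm0 e)]) e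
  simpa [hm0 e] using this


/-! ### Split polynomials and the discriminant in terms of the roots. -/

/-- The generic polynomial `∑ aᵢ Y^i` of degree `N`. -/
def genericPoly (R : Type*) [CommRing R] (N : ℕ) : Polynomial (MvPolynomial (Fin (N + 1)) R) :=
  ∑ i : Fin (N + 1),
    Polynomial.C (MvPolynomial.X i : MvPolynomial (Fin (N + 1)) R) * Polynomial.X ^ (i : ℕ)

theorem coeff_genericPoly (R : Type*) [CommRing R] (N : ℕ) (i : Fin (N + 1)) :
    (genericPoly R N).coeff i = MvPolynomial.X i := by
  simp only [genericPoly, Polynomial.finsetSum_coeff, Polynomial.coeff_C_mul_X_pow, Fin.val_inj]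
  simp

theorem natDegree_genericPoly_le (R : Type*) [CommRing R] (N : ℕ) :
    (genericPoly R N).natDegree ≤ N := by
  refine Polynomial.natDegree_sum_le_of_forall_le _ _ fun i _ => ?_
  exact (Polynomial.natDegree_C_mul_X_pow_le _ _).trans (Nat.lt_succ_iff.1 i.2)

theorem natDegree_genericPoly (R : Type*) [CommRing R] [Nontrivial R] (N : ℕ) :
    (genericPoly R N).natDegree = N := by
  refine le_antisymm (natDegree_genericPoly_le R N) (Polynomial.le_natDegree_of_ne_zero ?_)
  have := coeff_genericPoly R N (Fin.last N)
  rw [Fin.val_last] at this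
  rw [this]
  exact MvPolynomial.X_ne_zero _

theorem leadingCoeff_genericPoly (R : Type*) [CommRing R] [Nontrivial R] (N : ℕ) :
    (genericPoly R N).leadingCoeff = MvPolynomial.X (Fin.last N) := by
  rw [Polynomial.leadingCoeff, natDegree_genericPoly]
  exact coeff_genericPoly R N (Fin.last N)

/-- `c ∏ (Y - xᵢ)`. -/
def splitPoly {T : Type*} [CommRing T] {N : ℕ} (c : T) (x : Fin N → T) : Polynomial T :=
  Polynomial.C c * ∏ i, (Polynomial.X - Polynomial.C (x i))

theorem natDegree_splitPoly_le {T : Type*} [CommRing T] {N : ℕ} (c : T) (x : Fin N → T) :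
    (splitPoly c x).natDegree ≤ N := by
  nontriviality T
  refine (Polynomial.natDegree_C_mul_le _ _).trans ?_
  rw [Polynomial.natDegree_prod_of_monic _ _ fun i _ => Polynomial.monic_X_sub_C _]
  simp

theorem coeff_splitPoly_last {T : Type*} [CommRing T] {N : ℕ} (c : T) (x : Fin N → T) :
    (splitPoly c x).coeff N = c := by
  nontriviality T
  have hm : (∏ i, (Polynomial.X - Polynomial.C (x i))).Monic :=
    Polynomial.monic_prod_of_monic _ _ fun i _ => Polynomial.monic_X_sub_C _
  have hd : (∏ i, (Polynomial.X - Polynomial.C (x i))).natDegree = N := by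
    rw [Polynomial.natDegree_prod_of_monic _ _ fun i _ => Polynomial.monic_X_sub_C _]; simp
  rw [Polynomial.Monic, Polynomial.leadingCoeff, hd] at hm
  rw [splitPoly, Polynomial.coeff_C_mul, hm, mul_one]

theorem natDegree_splitPoly {T : Type*} [CommRing T] {N : ℕ} {c : T} (hc : c ≠ 0) (x : Fin N → T) :
    (splitPoly c x).natDegree = N :=
  le_antisymm (natDegree_splitPoly_le c x)
    (Polynomial.le_natDegree_of_ne_zero (by rwa [coeff_splitPoly_last]))

theorem map_splitPoly {T U : Type*} [CommRing T] [CommRing U] (χ : T →+* U) {N : ℕ} (c : T)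
    (x : Fin N → T) : (splitPoly c x).map χ = splitPoly (χ c) (χ ∘ x) := by
  simp [splitPoly, Polynomial.map_prod]

theorem eval_splitPoly {T : Type*} [CommRing T] {N : ℕ} (c y : T) (x : Fin N → T) :
    (splitPoly c x).eval y = c * ∏ i, (y - x i) := by
  simp [splitPoly, Polynomial.eval_prod]

/-- The product of the differences `xⱼ - xᵢ`, `i < j`. -/
def diffProd {T : Type*} [CommRing T] {N : ℕ} (x : Fin N → T) : T :=
  ∏ i, ∏ j ∈ Finset.Ioi i, (x j - x i)

theorem map_diffProd {T U : Type*} [CommRing T] [CommRing U] (χ : T →+* U) {N : ℕ}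
    (x : Fin N → T) : χ (diffProd x) = diffProd (χ ∘ x) := by
  simp [diffProd]

theorem diffProd_ne_zero {T : Type*} [CommRing T] [IsDomain T] {N : ℕ} {x : Fin N → T}
    (hx : Function.Injective x) : diffProd x ≠ 0 := by
  rw [diffProd, ← Matrix.det_vandermonde]
  exact Matrix.det_vandermonde_ne_zero_iff.2 hx

theorem diffProd_comp_perm {T : Type*} [CommRing T] {N : ℕ} (x : Fin N → T)
    (σ : Equiv.Perm (Fin N)) : diffProd (x ∘ σ) = ((Equiv.Perm.sign σ : ℤˣ) : ℤ) * diffProd x := by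
  rw [diffProd, diffProd, ← Matrix.det_vandermonde, ← Matrix.det_vandermonde,
    ← Matrix.det_permute]
  rfl

theorem prod_prod_compl_eq {T : Type*} [CommRing T] {N : ℕ} (x : Fin N → T) :
    ∏ i, ∏ j ∈ ({i} : Finset (Fin N))ᶜ, (x i - x j) = diffProd x ^ 2 ∨
    ∏ i, ∏ j ∈ ({i} : Finset (Fin N))ᶜ, (x i - x j) = - diffProd x ^ 2 := by
  have h : ∏ i, ∏ j ∈ ({i} : Finset (Fin N))ᶜ, (x i - x j) =
      (∏ i : Fin N, ∏ j ∈ Finset.Ioi i, (-1 : T)) * diffProd x ^ 2 := by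
    rw [diffProd, ← Finset.prod_pow, ← Finset.prod_mul_distrib,
      ← Finset.prod_prod_Ioi_mul_eq_prod_prod_off_diag (fun j i => x i - x j)]
    refine Finset.prod_congr rfl fun i _ => ?_
    rw [← Finset.prod_pow, ← Finset.prod_mul_distrib]
    exact Finset.prod_congr rfl fun j _ => by ring
  have h1 : (∏ i : Fin N, ∏ j ∈ Finset.Ioi i, (-1 : T)) = 1 ∨
      (∏ i : Fin N, ∏ j ∈ Finset.Ioi i, (-1 : T)) = -1 := by
    simp only [Finset.prod_const, Finset.prod_pow_eq_pow_sum]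
    exact neg_one_pow_eq_or _ _
  rcases h1 with h1 | h1 <;> rw [h, h1] <;> simp

theorem eval_derivative_splitPoly {T : Type*} [CommRing T] {N : ℕ} (c : T) (x : Fin N → T)
    (i : Fin N) : (splitPoly c x).derivative.eval (x i) =
      c * ∏ j ∈ ({i} : Finset (Fin N))ᶜ, (x i - x j) := by
  have h : splitPoly c x = (Polynomial.X - Polynomial.C (x i)) *
      (Polynomial.C c * ∏ j ∈ ({i} : Finset (Fin N))ᶜ, (Polynomial.X - Polynomial.C (x j))) := by
    rw [splitPoly, ← Finset.prod_mul_prod_compl ({i} : Finset (Fin N)), Finset.prod_singleton]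
    ring
  rw [h, Polynomial.derivative_mul]
  simp [Polynomial.eval_prod]

/-- The discriminant of `c ∏ (Y - xᵢ)` is `c^(2N-2) ∏_{i<j} (xⱼ - xᵢ)²`, up to sign. -/
theorem map_binaryDiscr_of_split {k T : Type*} [Field k] [CommRing T] [IsDomain T] {N : ℕ}
    (hN : 0 < N) (χ : MvPolynomial (Fin (N + 1)) k →+* T) {c : T} (hc : c ≠ 0) (x : Fin N → T)
    (h : (genericPoly k N).map χ = splitPoly c x) :
    χ (binaryDiscr k N) = c ^ (2 * N - 2) * diffProd x ^ 2 ∨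
      χ (binaryDiscr k N) = - (c ^ (2 * N - 2) * diffProd x ^ 2) := by
  have hlc : χ (MvPolynomial.X (Fin.last N)) = c := by
    rw [← coeff_genericPoly, ← Polynomial.coeff_map, h]
    exact coeff_splitPoly_last c x
  -- The resultant of f and f' is computed twice: generically as ± a_N times the discriminant, and
  -- for the split image as c^(N-1) times the product of the values of f' at the roots.
  have hres := Polynomial.resultant_deriv (f := genericPoly k N)
    (by rw [← Polynomial.natDegree_pos_iff_degree_pos, natDegree_genericPoly]; exact hN)
  have hD : (genericPoly k N).discr = binaryDiscr k N := rfl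
  rw [hD, natDegree_genericPoly, leadingCoeff_genericPoly] at hres
  have hres' := congrArg χ hres
  rw [← Polynomial.resultant_map_map, ← Polynomial.derivative_map, h] at hres'
  have hroots : (splitPoly c x).roots = Finset.univ.val.map x := by
    rw [splitPoly, Polynomial.roots_C_mul _ hc]
    have := Polynomial.roots_multiset_prod_X_sub_C (Finset.univ.val.map x)
    rwa [Multiset.map_map] at this
  have hsp : (splitPoly c x).Splits := by
    rw [splitPoly]
    exact (Polynomial.Splits.C c).mul (Polynomial.Splits.prod fun i _ => Polynomial.Splits.X_sub_C _)
  have hev := Polynomial.resultant_eq_prod_eval (splitPoly c x) (splitPoly c x).derivative (N - 1)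
    ((Polynomial.natDegree_derivative_le _).trans (by rw [natDegree_splitPoly hc])) hsp
  rw [hroots, Polynomial.leadingCoeff, natDegree_splitPoly hc, coeff_splitPoly_last, hres',
    Multiset.map_map] at hev
  have hprod : (Multiset.map ((fun y => (splitPoly c x).derivative.eval y) ∘ x)
      Finset.univ.val).prod = c ^ N * ∏ i, ∏ j ∈ ({i} : Finset (Fin N))ᶜ, (x i - x j) := by
    change ∏ i, (splitPoly c x).derivative.eval (x i) = _
    simp only [eval_derivative_splitPoly, Finset.prod_mul_distrib, Finset.prod_const,
      Finset.card_univ, Fintype.card_fin]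
  rw [hprod, map_mul, map_mul, map_pow, map_neg, map_one, hlc] at hev
  have hpow : c ^ (N - 1) * c ^ N = c * c ^ (2 * N - 2) := by
    rw [← pow_add, ← pow_succ']; congr 1; omega
  rw [← mul_assoc, hpow, mul_assoc, mul_left_comm _ c, mul_assoc c] at hev
  replace hev := mul_left_cancel₀ hc hev
  rcases neg_one_pow_eq_or T (N * (N - 1) / 2) with hs | hs <;>
    rcases prod_prod_compl_eq x with hp | hp <;> rw [hs, hp] at hev
  · left; simpa using hev
  · right; simpa using hev
  · right; rw [← hev]; ring
  · left; linear_combination -hev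


/-! ### Embedding polynomials in the coefficients into polynomials in the roots. -/

theorem map_genericPoly {R T : Type*} [CommRing R] [CommRing T] {N : ℕ}
    (χ : MvPolynomial (Fin (N + 1)) R →+* T) {f : Polynomial T} (hf : f.natDegree ≤ N)
    (h : ∀ i : Fin (N + 1), χ (MvPolynomial.X i) = f.coeff i) : (genericPoly R N).map χ = f := by
  ext i
  rw [Polynomial.coeff_map]
  by_cases hi : i < N + 1
  · rw [← h ⟨i, hi⟩, ← coeff_genericPoly R N ⟨i, hi⟩]
  · rw [Polynomial.coeff_eq_zero_of_natDegree_lt (n := i), map_zero,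
      Polynomial.coeff_eq_zero_of_natDegree_lt (by omega)]
    exact (natDegree_genericPoly_le R N).trans_lt (by omega)

theorem genericPoly_map {R R' : Type*} [CommRing R] [CommRing R'] (N : ℕ) (χ : R →+* R') :
    (genericPoly R N).map (MvPolynomial.map χ) = genericPoly R' N :=
  map_genericPoly _ (natDegree_genericPoly_le _ _) fun i => by
    rw [coeff_genericPoly, MvPolynomial.map_X]

/-- The ring in which the generic polynomial with leading coefficient `c` and roots `x₁, …, x_N`
lives. -/
abbrev SplitRing (R : Type*) [CommRing R] (N : ℕ) : Type _ := MvPolynomial (Fin N) (Polynomial R)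

/-- The leading coefficient of the generic split polynomial. -/
def splitLead (R : Type*) [CommRing R] (N : ℕ) : SplitRing R N := MvPolynomial.C Polynomial.X

/-- The map that sends the coefficients to those of the generic split polynomial. -/
def rootHom (R : Type*) [CommRing R] (N : ℕ) : MvPolynomial (Fin (N + 1)) R →ₐ[R] SplitRing R N :=
  MvPolynomial.aeval fun i => (splitPoly (splitLead R N) MvPolynomial.X).coeff i

theorem map_rootHom_genericPoly (R : Type*) [CommRing R] (N : ℕ) :
    (genericPoly R N).map (rootHom R N : MvPolynomial (Fin (N + 1)) R →+* SplitRing R N) =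
      splitPoly (splitLead R N) MvPolynomial.X :=
  map_genericPoly _ (natDegree_splitPoly_le _ _) fun i => by simp [rootHom]

theorem rootHom_X_last (R : Type*) [CommRing R] (N : ℕ) :
    rootHom R N (MvPolynomial.X (Fin.last N)) = splitLead R N := by
  simp [rootHom, coeff_splitPoly_last]

/-- A polynomial over a field which splits is of the form `c ∏ (Y - xᵢ)`. -/
theorem exists_eq_splitPoly {L : Type*} [Field L] [IsAlgClosed L] (f : Polynomial L) :
    ∃ x : Fin f.natDegree → L, f = splitPoly f.leadingCoeff x := by
  have hs := IsAlgClosed.splits f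
  have hcard := hs.natDegree_eq_card_roots
  obtain ⟨l, hl⟩ := Quot.exists_rep f.roots
  have hl' : (l : Multiset L) = f.roots := hl
  have hlen : l.length = f.natDegree := by rw [hcard, ← hl']; rfl
  have key : ∀ m : ℕ, l.length = m → ∃ x : Fin m → L, List.ofFn x = l := by
    rintro m rfl
    exact ⟨l.get, List.ofFn_get l⟩
  obtain ⟨x, hx⟩ := key _ hlen
  refine ⟨x, ?_⟩
  conv_lhs => rw [hs.eq_prod_roots, ← hl', ← hx]
  rw [splitPoly, Multiset.map_coe, Multiset.prod_coe, List.map_ofFn, List.prod_ofFn]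
  rfl

/-- The generic polynomial splits over an algebraic closure of the fraction field of the coefficient
ring. Sending c to a_N and the xᵢ to the roots there, the composite with `rootHom` is the inclusion
of the coefficient ring. -/
theorem rootHom_injective (R : Type*) [CommRing R] [IsDomain R] (N : ℕ) :
    Function.Injective (rootHom R N) := by
  let A := MvPolynomial (Fin (N + 1)) R
  let L := AlgebraicClosure (FractionRing A)
  let ι : A →+* L := (algebraMap (FractionRing A) L).comp (algebraMap A (FractionRing A))
  have hι : Function.Injective ι :=
    (algebraMap (FractionRing A) L).injective.comp (IsFractionRing.injective A _)
  obtain ⟨x, hx⟩ := exists_eq_splitPoly ((genericPoly R N).map ι)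
  rw [Polynomial.leadingCoeff_map_of_injective hι] at hx
  have hdeg : ((genericPoly R N).map ι).natDegree = N := by
    rw [Polynomial.natDegree_map_eq_of_injective hι, natDegree_genericPoly]
  -- The roots are indexed by the degree, so N is replaced by that degree to avoid casts.
  generalize ((genericPoly R N).map ι).natDegree = m at x hx hdeg
  subst hdeg
  let τ : SplitRing R m →+* L :=
    MvPolynomial.eval₂Hom (Polynomial.eval₂RingHom (ι.comp MvPolynomial.C)
      (ι (genericPoly R m).leadingCoeff)) x
  have hτ : τ.comp (rootHom R m : A →+* SplitRing R m) = ι := by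
    refine MvPolynomial.ringHom_ext (fun a => ?_) fun i => ?_
    · have : rootHom R m (MvPolynomial.C a) = MvPolynomial.C (Polynomial.C a) :=
        (rootHom R m).commutes a
      simp only [RingHom.comp_apply, RingHom.coe_coe, this]
      simp [τ]
    · rw [RingHom.comp_apply, ← coeff_genericPoly, ← Polynomial.coeff_map, ← Polynomial.coeff_map,
        map_rootHom_genericPoly, map_splitPoly, ← Polynomial.coeff_map, hx]
      congr 2
      · simp [τ, splitLead]
      · funext j; simp [τ]
  refine Function.Injective.of_comp (f := τ) ?_
  have : (τ ∘ rootHom R m) = ι := by rw [← hτ]; rfl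
  rw [this]
  exact hι

theorem rename_rootHom (R : Type*) [CommRing R] (N : ℕ) (ρ : Fin N → Fin N)
    (G : MvPolynomial (Fin (N + 1)) R) :
    MvPolynomial.rename ρ (rootHom R N G) =
      MvPolynomial.aeval (fun i : Fin (N + 1) =>
        (splitPoly (splitLead R N) (MvPolynomial.X ∘ ρ)).coeff i) G := by
  have : ((MvPolynomial.rename ρ).restrictScalars R).comp (rootHom R N) =
      MvPolynomial.aeval (fun i : Fin (N + 1) =>
        (splitPoly (splitLead R N) (MvPolynomial.X ∘ ρ)).coeff i) := by
    refine MvPolynomial.algHom_ext fun i => ?_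
    have h := map_splitPoly (MvPolynomial.rename (R := Polynomial R) ρ).toRingHom
      (splitLead R N) MvPolynomial.X
    simp only [AlgHom.comp_apply, rootHom, MvPolynomial.aeval_X, AlgHom.restrictScalars_apply]
    have h2 := congrArg (fun p => p.coeff (i : ℕ)) h
    simp only [Polynomial.coeff_map] at h2
    refine h2.trans ?_
    congr 2
    · simp [splitLead]
    · funext j; simp
  exact DFunLike.congr_fun this G

theorem rootHom_isSymmetric (R : Type*) [CommRing R] (N : ℕ) (G : MvPolynomial (Fin (N + 1)) R) :
    (rootHom R N G).IsSymmetric := by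
  intro σ
  rw [rename_rootHom]
  have : splitPoly (splitLead R N) ((MvPolynomial.X : Fin N → SplitRing R N) ∘ σ) =
      splitPoly (splitLead R N) MvPolynomial.X := by
    rw [splitPoly, splitPoly]
    congr 1
    exact Equiv.prod_comp σ fun i => (Polynomial.X - Polynomial.C (MvPolynomial.X i))
  rw [this]
  rfl

theorem rootHom_binaryDiscr {k : Type*} (R : Type*) [Field k] [CommRing R] [IsDomain R] [Algebra k R] {N : ℕ}
    (hN : 0 < N) :
    rootHom R N (MvPolynomial.map (algebraMap k R) (binaryDiscr k N)) =
        splitLead R N ^ (2 * N - 2) * diffProd (MvPolynomial.X : Fin N → SplitRing R N) ^ 2 ∨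
      rootHom R N (MvPolynomial.map (algebraMap k R) (binaryDiscr k N)) =
        - (splitLead R N ^ (2 * N - 2) *
          diffProd (MvPolynomial.X : Fin N → SplitRing R N) ^ 2) := by
  refine map_binaryDiscr_of_split hN ((rootHom R N : _ →+* SplitRing R N).comp
    (MvPolynomial.map (algebraMap k R))) ?_ _ ?_
  · rw [splitLead, Ne, MvPolynomial.C_eq_zero]
    exact Polynomial.X_ne_zero
  · rw [← Polynomial.map_map, genericPoly_map, map_rootHom_genericPoly]

/-- The leading coefficient does not divide the discriminant. -/
theorem not_X_last_dvd_binaryDiscr {k : Type*} (R : Type*) [Field k] [CommRing R] [IsDomain R]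
    [Algebra k R] {N : ℕ} (hN : 0 < N) :
    ¬ MvPolynomial.X (Fin.last N) ∣ MvPolynomial.map (algebraMap k R) (binaryDiscr k N) := by
  obtain ⟨m, rfl⟩ : ∃ m, N = m + 1 := ⟨N - 1, by omega⟩
  rintro ⟨D', hD'⟩
  let F := AlgebraicClosure (FractionRing R)
  let ι : R →+* F := (algebraMap (FractionRing R) F).comp (algebraMap R (FractionRing R))
  let y : Fin m → F := fun i => (Infinite.natEmbedding F) i
  have hy : Function.Injective y := fun i j h => Fin.ext ((Infinite.natEmbedding F).injective h)
  let T := FractionRing (Polynomial F)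
  let t : T := algebraMap (Polynomial F) T Polynomial.X
  have hinj : Function.Injective (algebraMap (Polynomial F) T) := IsFractionRing.injective _ _
  have ht : t ≠ 0 := by
    rw [Ne, map_eq_zero_iff _ hinj]; exact Polynomial.X_ne_zero
  -- A family over the t-line with leading coefficient -t, whose root 1/t escapes to infinity as t
  -- tends to 0 while the other roots stay fixed and distinct. Its discriminant is nonzero at t = 0,
  -- so it is not divisible by t.
  let f : Polynomial (Polynomial F) := (1 - Polynomial.C Polynomial.X * Polynomial.X) *
    ∏ i, (Polynomial.X - Polynomial.C (Polynomial.C (y i)))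
  let χ : MvPolynomial (Fin (m + 1 + 1)) R →+* Polynomial F :=
    MvPolynomial.eval₂Hom (Polynomial.C.comp ι) fun i => f.coeff i
  let z : Fin (m + 1) → T := Fin.cons t⁻¹ fun i => algebraMap (Polynomial F) T (Polynomial.C (y i))
  have hfz : f.map (algebraMap (Polynomial F) T) = splitPoly (-t) z := by
    simp only [f, splitPoly, Polynomial.map_mul, Polynomial.map_sub, Polynomial.map_prod,
      Fin.prod_univ_succ, z, Fin.cons_zero, Fin.cons_succ, Polynomial.map_C, Polynomial.map_X,
      Polynomial.map_one]
    rw [← mul_assoc]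
    congr 1
    have : Polynomial.C t * Polynomial.C t⁻¹ = 1 := by
      rw [← Polynomial.C_mul, mul_inv_cancel₀ ht, Polynomial.C_1]
    change 1 - Polynomial.C t * _ = _
    rw [Polynomial.C_neg]
    linear_combination -this
  have hfdeg : f.natDegree ≤ m + 1 := by
    rw [← Polynomial.natDegree_map_eq_of_injective hinj, hfz]
    exact natDegree_splitPoly_le _ _
  have hlast : χ (MvPolynomial.X (Fin.last (m + 1))) = - Polynomial.X := by
    apply hinj
    simp only [χ, MvPolynomial.coe_eval₂Hom, MvPolynomial.eval₂_X]
    rw [Fin.val_last, ← Polynomial.coeff_map, hfz, coeff_splitPoly_last, map_neg]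
  have hgen : (genericPoly k (m + 1)).map
      (((algebraMap (Polynomial F) T).comp χ).comp (MvPolynomial.map (algebraMap k R))) =
      splitPoly (-t) z := by
    rw [← hfz, ← Polynomial.map_map, genericPoly_map, ← Polynomial.map_map]
    congr 1
    refine map_genericPoly _ hfdeg fun i => ?_
    simp [χ]
  have hspl := map_binaryDiscr_of_split (by omega) _ (neg_ne_zero.2 ht) z hgen
  rw [RingHom.comp_apply, RingHom.comp_apply, hD', map_mul χ, hlast] at hspl
  have hz : (-t) ^ (2 * (m + 1) - 2) * diffProd z ^ 2 = algebraMap (Polynomial F) T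
      ((∏ i, (Polynomial.X * Polynomial.C (y i) - 1)) ^ 2 *
        diffProd (fun i => Polynomial.C (y i)) ^ 2) := by
    have h1 : diffProd z = (∏ i, (algebraMap (Polynomial F) T (Polynomial.C (y i)) - t⁻¹)) *
        diffProd (fun i => algebraMap (Polynomial F) T (Polynomial.C (y i))) := by
      rw [diffProd, Fin.prod_univ_succ]
      congr 1
      · simp only [Fin.Ioi_zero_eq_map, Finset.prod_map]
        rfl
      · refine Finset.prod_congr rfl fun i _ => ?_
        rw [← Fin.map_succEmb_Ioi, Finset.prod_map]
        rfl
    -- The factor t^m, half of the power of the leading coefficient, cancels the poles of the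
    -- differences with the root 1/t.
    have h2 : t ^ m * ∏ i, (algebraMap (Polynomial F) T (Polynomial.C (y i)) - t⁻¹) =
        algebraMap (Polynomial F) T (∏ i, (Polynomial.X * Polynomial.C (y i) - 1)) := by
      rw [map_prod]
      have : t ^ m = ∏ i : Fin m, t := by simp
      rw [this, ← Finset.prod_mul_distrib]
      refine Finset.prod_congr rfl fun i _ => ?_
      rw [mul_sub, mul_inv_cancel₀ ht, map_sub, map_mul, map_one]
    have h3 : (-t) ^ (2 * (m + 1) - 2) = (t ^ m) ^ 2 := by
      rw [show 2 * (m + 1) - 2 = 2 * m by omega, pow_mul, neg_sq, ← pow_mul, ← pow_mul, mul_comm]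
    rw [h3, h1, map_mul, map_pow, map_pow, ← h2, map_diffProd]
    simp only [Function.comp_def]
    ring
  rw [hz, ← map_neg] at hspl
  have hev : Polynomial.eval 0 ((∏ i, (Polynomial.X * Polynomial.C (y i) - 1)) ^ 2 *
        diffProd (fun i => Polynomial.C (y i)) ^ 2) ≠ 0 := by
    have : Polynomial.eval 0 (diffProd (fun i => Polynomial.C (y i))) = diffProd y := by
      have := map_diffProd (Polynomial.evalRingHom (0 : F)) (fun i => Polynomial.C (y i))
      simpa [Function.comp_def] using this
    simp [Polynomial.eval_prod, this, diffProd_ne_zero hy]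
  rcases hspl with h | h
  · exact hev (by rw [← hinj h]; simp)
  · refine hev (neg_eq_zero.1 ?_)
    rw [← Polynomial.eval_neg, ← hinj h]; simp


/-! ### Symmetric polynomials vanishing on a diagonal. -/

theorem X_sub_dvd_iff {σ A : Type*} [DecidableEq σ] [CommRing A] (j : σ)
    {a : MvPolynomial σ A}
    (ha : MvPolynomial.aeval (Function.update MvPolynomial.X j a) a = a) (g : MvPolynomial σ A) :
    (MvPolynomial.X j - a) ∣ g ↔
      MvPolynomial.aeval (Function.update MvPolynomial.X j a) g = 0 := by
  constructor
  · rintro ⟨h, rfl⟩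
    rw [map_mul, map_sub, MvPolynomial.aeval_X, Function.update_self, ha, sub_self, zero_mul]
  · intro h
    let I : Ideal (MvPolynomial σ A) := Ideal.span {MvPolynomial.X j - a}
    -- Modulo X j - a, substituting a for X j changes nothing.
    have hI : ((Ideal.Quotient.mkₐ A I).comp
        (MvPolynomial.aeval (Function.update MvPolynomial.X j a))) = Ideal.Quotient.mkₐ A I := by
      refine MvPolynomial.algHom_ext fun l => ?_
      by_cases hl : l = j
      · subst hl
        simp only [AlgHom.comp_apply, MvPolynomial.aeval_X, Function.update_self]
        refine (Ideal.Quotient.eq.2 ?_).symm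
        exact Ideal.mem_span_singleton_self _
      · simp [hl]
    have h1 := DFunLike.congr_fun hI g
    rw [AlgHom.comp_apply, h, map_zero] at h1
    exact Ideal.mem_span_singleton.1 (Ideal.Quotient.eq_zero_iff_mem.1 h1.symm)

theorem prime_X_sub {σ A : Type*} [DecidableEq σ] [CommRing A] [IsDomain A] (j : σ)
    {a : MvPolynomial σ A} (ha : MvPolynomial.aeval (Function.update MvPolynomial.X j a) a = a)
    (hne : MvPolynomial.X j ≠ a) : Prime (MvPolynomial.X j - a) := by
  refine ⟨sub_ne_zero.2 hne, ?_, ?_⟩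
  · intro h
    exact (h.map (MvPolynomial.aeval (R := A) (Function.update MvPolynomial.X j a))).ne_zero
      ((X_sub_dvd_iff j ha _).1 (dvd_refl _))
  · intro b c h
    simpa only [X_sub_dvd_iff j ha, map_mul, mul_eq_zero] using h

theorem aeval_update_X_self {σ A : Type*} [DecidableEq σ] [CommRing A] (i j : σ) :
    MvPolynomial.aeval (Function.update MvPolynomial.X j (MvPolynomial.X i : MvPolynomial σ A))
      (MvPolynomial.X i : MvPolynomial σ A) = MvPolynomial.X i := by
  by_cases h : i = j <;> simp [h]

theorem X_sub_X_dvd_iff {σ A : Type*} [DecidableEq σ] [CommRing A] (i j : σ)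
    (g : MvPolynomial σ A) :
    (MvPolynomial.X j - MvPolynomial.X i) ∣ g ↔
      MvPolynomial.rename (Function.update id j i) g = 0 := by
  rw [X_sub_dvd_iff j (aeval_update_X_self i j), MvPolynomial.rename_eq_aeval]
  congr! 3
  funext l
  by_cases hl : l = j <;> simp [hl]

theorem prime_X_sub_X {σ A : Type*} [DecidableEq σ] [CommRing A] [IsDomain A] {i j : σ}
    (hij : i ≠ j) : Prime (MvPolynomial.X j - MvPolynomial.X i : MvPolynomial σ A) :=
  prime_X_sub j (aeval_update_X_self i j) fun h => hij (MvPolynomial.X_injective h).symm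

/-- The differences X j - X i with i < j are pairwise non-associated primes, so divisibility by
their product can be tested on each diagonal separately. -/
theorem diffProd_X_dvd {A : Type*} [CommRing A] [IsDomain A] [UniqueFactorizationMonoid A] {N : ℕ}
    {g : MvPolynomial (Fin N) A}
    (h : ∀ i j, i < j → MvPolynomial.rename (Function.update id j i) g = 0) :
    diffProd (MvPolynomial.X : Fin N → MvPolynomial (Fin N) A) ∣ g := by
  rw [diffProd, Finset.prod_sigma']
  refine Finset.prod_dvd_of_isRelPrime ?_ ?_
  · rintro ⟨i, j⟩ hij ⟨k, l⟩ hkl hne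
    simp only [Finset.coe_sigma, Set.mem_sigma_iff, Finset.coe_univ, Set.mem_univ, true_and,
      Finset.mem_coe, Finset.mem_Ioi] at hij hkl
    refine ((prime_X_sub_X hij.ne).irreducible.isRelPrime_iff_not_dvd).2 fun hd => ?_
    rw [X_sub_X_dvd_iff, map_sub, MvPolynomial.rename_X, MvPolynomial.rename_X, sub_eq_zero] at hd
    have := MvPolynomial.X_injective hd
    simp only [Function.update_apply, id] at this
    apply hne
    split_ifs at this with h1 h2 h2
    · exact absurd (h1.trans h2.symm) hkl.ne'
    · rw [h1, this]
    · subst h2 this; exact absurd (hij.trans hkl) (lt_irrefl _)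
    · exact absurd this hkl.ne'
  · rintro ⟨i, j⟩ hij
    simp only [Finset.mem_sigma, Finset.mem_univ, true_and, Finset.mem_Ioi] at hij
    exact (X_sub_X_dvd_iff i j g).2 (h i j hij)

theorem rename_diffProd_X {A : Type*} [CommRing A] {N : ℕ} (σ : Equiv.Perm (Fin N)) :
    MvPolynomial.rename σ (diffProd (MvPolynomial.X : Fin N → MvPolynomial (Fin N) A)) =
      ((Equiv.Perm.sign σ : ℤˣ) : ℤ) *
        diffProd (MvPolynomial.X : Fin N → MvPolynomial (Fin N) A) := by
  rw [← diffProd_comp_perm]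
  refine (map_diffProd (MvPolynomial.rename (R := A) σ).toRingHom _).trans ?_
  congr 1
  funext i
  simp

/-- A symmetric polynomial that vanishes on one diagonal is divisible by the squares of all
differences, with a symmetric quotient. -/
theorem exists_eq_diffProd_sq_mul {A : Type*} [CommRing A] [IsDomain A]
    [UniqueFactorizationMonoid A] (h2 : (2 : A) ≠ 0) {N : ℕ} {i₀ i₁ : Fin N} (h01 : i₀ ≠ i₁)
    {g : MvPolynomial (Fin N) A} (hg : g.IsSymmetric)
    (h : MvPolynomial.rename (Function.update id i₁ i₀) g = 0) :
    ∃ H : MvPolynomial (Fin N) A, H.IsSymmetric ∧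
      g = diffProd (MvPolynomial.X : Fin N → MvPolynomial (Fin N) A) ^ 2 * H := by
  set W := diffProd (MvPolynomial.X : Fin N → MvPolynomial (Fin N) A) with hW
  have hW0 : W ≠ 0 := diffProd_ne_zero (MvPolynomial.X_injective)
  have hall : ∀ i j, i < j → MvPolynomial.rename (Function.update id j i) g = 0 := by
    intro i j hij
    -- A permutation carrying the pair (i₀, i₁) to (i, j), so that symmetry transports the vanishing
    -- from one diagonal to all.
    let σ : Equiv.Perm (Fin N) := Equiv.swap i₀ i * Equiv.swap i₁ (Equiv.swap i₀ i j)
    have h0 : σ i₀ = i := by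
      have : i₀ ≠ Equiv.swap i₀ i j := by
        intro h
        have := congrArg (Equiv.swap i₀ i) h
        rw [Equiv.swap_apply_left, Equiv.swap_apply_self] at this
        exact hij.ne this
      simp only [σ, Equiv.Perm.mul_apply]
      rw [Equiv.swap_apply_of_ne_of_ne h01 this, Equiv.swap_apply_left]
    have h1 : σ i₁ = j := by
      simp only [σ, Equiv.Perm.mul_apply]
      rw [Equiv.swap_apply_left, Equiv.swap_apply_self]
    have hc : (Function.update id j i) ∘ σ = σ ∘ (Function.update id i₁ i₀) := by
      funext a
      by_cases ha : a = i₁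
      · subst ha; simp [h0, h1]
      · have : σ a ≠ j := fun h => ha (σ.injective (h.trans h1.symm))
        simp [ha, this]
    rw [← hg σ, MvPolynomial.rename_rename, hc, ← MvPolynomial.rename_rename, h, map_zero]
  obtain ⟨g₁, hg₁⟩ := diffProd_X_dvd hall
  rw [← hW] at hg₁
  -- The first quotient g₁ is antisymmetric, so on the diagonal it equals its own negative and
  -- vanishes because 2 ≠ 0. It is therefore divisible by the product of differences a second time.
  have hsymm : ∀ i j, i < j → MvPolynomial.rename (Function.update id j i) g₁ = 0 := by
    intro i j hij
    have h3 : MvPolynomial.rename (Equiv.swap i j) g₁ = - g₁ := by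
      have := hg (Equiv.swap i j)
      rw [hg₁, map_mul, hW, rename_diffProd_X, ← hW, Equiv.Perm.sign_swap hij.ne] at this
      refine mul_left_cancel₀ hW0 ?_
      push_cast at this
      linear_combination -this
    have hc : (Function.update id j i) ∘ (Equiv.swap i j) = Function.update id j i := by
      funext a
      simp only [Function.comp_apply, Function.update_apply, id, Equiv.swap_apply_def]
      split_ifs <;> simp_all
    have h4 := congrArg (MvPolynomial.rename (R := A) (Function.update id j i)) h3
    rw [MvPolynomial.rename_rename, hc, map_neg, eq_neg_iff_add_eq_zero, ← two_mul] at h4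
    have : (2 : MvPolynomial (Fin N) A) ≠ 0 := by
      rw [← map_ofNat (MvPolynomial.C (σ := Fin N) (R := A)) 2, Ne, MvPolynomial.C_eq_zero]
      exact h2
    exact (mul_eq_zero.1 h4).resolve_left this
  obtain ⟨H, hH⟩ := diffProd_X_dvd hsymm
  rw [← hW] at hH
  have hgH : g = W ^ 2 * H := by rw [hg₁, hH]; ring
  refine ⟨H, fun σ => ?_, hgH⟩
  have := hg σ
  rw [hgH, map_mul, map_pow, hW, rename_diffProd_X, ← hW, mul_pow, ← Int.cast_pow, ← Units.val_pow_eq_pow_val,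
    Int.units_sq, Units.val_one, Int.cast_one, one_mul] at this
  exact mul_left_cancel₀ (pow_ne_zero 2 hW0) this

/-! ### Descent from the roots to the coefficients. -/

/-- Up to a power of the leading coefficient, symmetric polynomials in the roots are polynomials in
the coefficients. -/
theorem exists_rootHom_eq {R : Type*} [CommRing R] {N : ℕ} {H : SplitRing R N}
    (hH : H.IsSymmetric) : ∃ M Q, splitLead R N ^ M * H = rootHom R N Q := by
  obtain ⟨P, hP⟩ := MvPolynomial.esymmAlgHom_surjective (σ := Fin N) (n := N) (Polynomial R)
    (by simp) ⟨H, hH⟩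
  have hP' : H = MvPolynomial.aeval (fun i : Fin N => MvPolynomial.esymm (Fin N) (Polynomial R)
      (i + 1)) P := by
    rw [← MvPolynomial.esymmAlgHom_apply, hP]
  rw [hP']
  clear hP' hP hH H
  induction P using MvPolynomial.induction_on with
  | C p =>
    refine ⟨0, Polynomial.aeval (MvPolynomial.X (Fin.last N)) p, ?_⟩
    rw [← Polynomial.aeval_algHom_apply, rootHom_X_last, pow_zero, one_mul]
    induction p using Polynomial.induction_on' with
    | add p q hp hq => simp only [map_add, hp, hq]
    | monomial m a =>
      rw [← Polynomial.C_mul_X_pow_eq_monomial]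
      simp [splitLead]
  | add p q hp hq =>
    obtain ⟨M, Q, h⟩ := hp
    obtain ⟨M', Q', h'⟩ := hq
    refine ⟨M + M', MvPolynomial.X (Fin.last N) ^ M' * Q + MvPolynomial.X (Fin.last N) ^ M * Q', ?_⟩
    rw [map_add, map_add, map_mul, map_mul, map_pow, map_pow, rootHom_X_last, ← h, ← h']
    ring
  | mul_X p i hp =>
    obtain ⟨M, Q, h⟩ := hp
    -- Vieta: c times an elementary symmetric polynomial is a coefficient up to sign, so each such
    -- factor costs one power of c.
    have hi : splitLead R N * MvPolynomial.esymm (Fin N) (Polynomial R) (i + 1) =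
        rootHom R N ((-1) ^ ((i : ℕ) + 1) * MvPolynomial.X ⟨N - (i + 1), by omega⟩) := by
      have hc := Multiset.prod_X_sub_C_coeff
        (Finset.univ.val.map (MvPolynomial.X : Fin N → SplitRing R N)) (k := N - (i + 1))
        (by simp)
      have hNi : N - (N - ((i : ℕ) + 1)) = i + 1 := by omega
      rw [Multiset.map_map, Multiset.card_map, Finset.card_val, Finset.card_univ,
        Fintype.card_fin, hNi, ← MvPolynomial.esymm_eq_multiset_esymm] at hc
      have h1 : rootHom R N (MvPolynomial.X ⟨N - (i + 1), by omega⟩) =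
          splitLead R N * ((-1) ^ ((i : ℕ) + 1) *
            MvPolynomial.esymm (Fin N) (Polynomial R) (i + 1)) := by
        rw [← hc, rootHom, MvPolynomial.aeval_X, splitPoly, Polynomial.coeff_C_mul]
        rfl
      have h2 : (-1 : SplitRing R N) ^ ((i : ℕ) + 1) * (-1) ^ ((i : ℕ) + 1) = 1 :=
        pow_mul_pow_eq_one _ (by ring)
      rw [map_mul, map_pow, map_neg, map_one, h1]
      linear_combination -(splitLead R N *
        MvPolynomial.esymm (Fin N) (Polynomial R) (i + 1)) * h2
    refine ⟨M + 1, Q * ((-1) ^ ((i : ℕ) + 1) * MvPolynomial.X ⟨N - (i + 1), by omega⟩), ?_⟩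
    rw [map_mul, map_mul, MvPolynomial.aeval_X, ← h, ← hi]
    ring

/-- A polynomial in the coefficients which vanishes on the forms with a double root is divisible by
the discriminant. -/
theorem binaryDiscr_dvd {k R : Type*} [Field k] [CommRing R] [IsDomain R]
    [UniqueFactorizationMonoid R] [Algebra k R] (h2 : (2 : k) ≠ 0) {N : ℕ} {i₀ i₁ : Fin N}
    (h01 : i₀ ≠ i₁) {G : MvPolynomial (Fin (N + 1)) R}
    (hG : MvPolynomial.rename (Function.update id i₁ i₀) (rootHom R N G) = 0) :
    MvPolynomial.map (algebraMap k R) (binaryDiscr k N) ∣ G := by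
  have hN : 0 < N := (Nat.zero_le _).trans_lt i₀.2
  have h2' : (2 : Polynomial R) ≠ 0 := by
    have : (2 : R) ≠ 0 := by
      rw [← map_ofNat (algebraMap k R) 2]
      simpa using h2
    rw [← map_ofNat (Polynomial.C (R := R)) 2, Ne, Polynomial.C_eq_zero]
    exact this
  obtain ⟨H, hH, hGH⟩ := exists_eq_diffProd_sq_mul h2' h01 (rootHom_isSymmetric R N G) hG
  obtain ⟨M, Q, hQ⟩ := exists_rootHom_eq hH
  set D := MvPolynomial.map (algebraMap k R) (binaryDiscr k N) with hD
  have hdvd : MvPolynomial.X (Fin.last N) ^ (2 * N - 2 + M) * G = D * Q ∨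
      MvPolynomial.X (Fin.last N) ^ (2 * N - 2 + M) * G = D * -Q := by
    rcases rootHom_binaryDiscr (k := k) R hN with h | h
    · left
      apply rootHom_injective R N
      rw [map_mul, map_mul, map_pow, rootHom_X_last, hGH, h, ← hQ]
      ring
    · right
      apply rootHom_injective R N
      rw [map_mul, map_mul, map_pow, map_neg, rootHom_X_last, hGH, h, ← hQ]
      ring
  -- The variable a_N is prime and does not divide D, so its power divides Q and can be cancelled.
  have key : ∀ Q, MvPolynomial.X (Fin.last N) ^ (2 * N - 2 + M) * G = D * Q → D ∣ G := by
    intro Q hQ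
    have hp : Prime (MvPolynomial.X (Fin.last N) : MvPolynomial (Fin (N + 1)) R) :=
      MvPolynomial.X_prime
    obtain ⟨Q', rfl⟩ := hp.pow_dvd_of_dvd_mul_left _
      (not_X_last_dvd_binaryDiscr (k := k) R hN) (Dvd.intro _ hQ)
    exact ⟨Q', mul_left_cancel₀ (pow_ne_zero _ hp.ne_zero) (by rw [hQ]; ring)⟩
  rcases hdvd with h | h <;> exact key _ h


/-! ### Field-valued points of 𝔸_{r,n}. -/

/-- The points `1, p₁, …, p_{n-3}`, for values `pⱼ`. -/
def nodeVal {L : Type*} [One L] {n : ℕ} (p : Fin (n - 3) → L) (j : Fin (n - 2)) : L :=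
  if h : (j : ℕ) = 0 then 1 else p ⟨(j : ℕ) - 1, by have := j.2; omega⟩

theorem nodeVal_ne_zero {L : Type*} [Field L] {n : ℕ} {p : Fin (n - 3) → L}
    (hp0 : ∀ j, p j ≠ 0) (j : Fin (n - 2)) : nodeVal p j ≠ 0 := by
  unfold nodeVal
  split_ifs
  · exact one_ne_zero
  · exact hp0 _

theorem nodeVal_injective {L : Type*} [One L] {n : ℕ} {p : Fin (n - 3) → L}
    (hp : Function.Injective p) (hp1 : ∀ j, p j ≠ 1) : Function.Injective (nodeVal p) := by
  intro i j h
  unfold nodeVal at h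
  split_ifs at h with h1 h2 h2
  · exact Fin.ext (h1.trans h2.symm)
  · exact absurd h.symm (hp1 _)
  · exact absurd h (hp1 _)
  · have := congrArg Fin.val (hp h)
    simp only at this
    exact Fin.ext (by omega)

theorem map_nodeVal {L L' : Type*} [CommRing L] [CommRing L'] (χ : L →+* L') {n : ℕ}
    (p : Fin (n - 3) → L) (j : Fin (n - 2)) : χ (nodeVal p j) = nodeVal (χ ∘ p) j := by
  unfold nodeVal
  split_ifs <;> simp

theorem node_eq_nodeVal (k : Type*) [Field k] (N n : ℕ) :
    node k N n = nodeVal fun j => coordFun k N n (Coord.p j) := rfl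

/-- A field valued point of the space of forms lifts to the space of forms with sections, if the
points and the roots of the values of the form are given. -/
theorem exists_specialization {k L : Type*} [Field k] [Field L] [Algebra k L] {r N n : ℕ}
    (hn : n ≤ N + 1) {f : Polynomial L} (hf : f.natDegree ≤ N) {p : Fin (n - 3) → L}
    (hp : Function.Injective p) (hp0 : ∀ j, p j ≠ 0) (hp1 : ∀ j, p j ≠ 1) {s : Fin n → L}
    (hs0 : ∀ h : 0 < n, s ⟨0, h⟩ ^ r = f.coeff N) (hs1 : ∀ h : 1 < n, s ⟨1, h⟩ ^ r = f.coeff 0)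
    (hs2 : ∀ j : Fin (n - 2), s ⟨j + 2, by have := j.2; omega⟩ ^ r = f.eval (nodeVal p j)) :
    ∃ ψ : CoordRing k N n →ₐ[k] L, (∀ j, ψ (coordFun k N n (Coord.p j)) = p j) ∧
      (∀ j, ψ (coordFun k N n (Coord.s j)) = s j) ∧
      ∀ i, ψ (formCoeff k r N n i) = f.coeff i := by
  let v : Coord N n → L
    | Coord.a i => f.coeff i
    | Coord.p j => p j
    | Coord.s j => s j
  let ψ₀ : MvPolynomial (Coord N n) k →ₐ[k] L := MvPolynomial.aeval v
  have hbad : ψ₀ (badLocus k N n) ≠ 0 := by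
    simp only [ψ₀, badLocus, map_mul, map_prod, map_sub, MvPolynomial.aeval_X, map_one, v]
    refine mul_ne_zero (Finset.prod_ne_zero_iff.2 fun j _ =>
      mul_ne_zero (hp0 j) (sub_ne_zero.2 (hp1 j))) (Finset.prod_ne_zero_iff.2 fun i _ =>
      Finset.prod_ne_zero_iff.2 fun j hj => sub_ne_zero.2 fun h => ?_)
    exact (Finset.mem_Ioi.1 hj).ne' (hp h)
  let ψ : CoordRing k N n →ₐ[k] L := IsLocalization.liftAlgHom (M := Submonoid.powers (badLocus k N n))
    (f := ψ₀) (by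
      rintro ⟨_, m, rfl⟩
      simpa using pow_ne_zero m hbad |>.isUnit)
  have hψ : ∀ c, ψ (coordFun k N n c) = v c := by
    intro c
    simp [ψ, coordFun, ψ₀]
  have hnode : ∀ j, ψ (node k N n j) = nodeVal p j := by
    intro j
    rw [node_eq_nodeVal]
    refine (map_nodeVal ψ.toRingHom _ j).trans ?_
    congr 1
    funext i
    exact hψ _
  have hknown : ∀ i : Fin (N + 1), ¬ (N + 2 - n ≤ (i : ℕ) ∧ (i : ℕ) - (N + 2 - n) < n - 2) →
      ψ (formCoeff k r N n i) = f.coeff i := by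
    intro i hi
    by_cases hfree : IsFree N n i
    · rw [formCoeff_free k r N n hn i hfree, hψ]
    · by_cases h1 : 1 ≤ n
      · by_cases hN : i = Fin.last N
        · subst hN
          rw [formCoeff_last k r N n h1 hn, map_pow, sec, dif_pos (show 0 < n from h1), hψ]
          exact hs0 h1
        · by_cases h2 : 2 ≤ n
          · have h0 : i = 0 := by
              by_contra h0
              have h3 : (i : ℕ) ≠ 0 := fun h => h0 (Fin.ext h)
              have h4 : (i : ℕ) ≠ N := fun h => hN (Fin.ext h)
              have := i.2
              exact hfree ⟨by omega, fun _ => by omega, fun _ => ⟨by omega, by omega⟩⟩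
            subst h0
            rw [formCoeff_zero k r N n h2 hn, map_pow, sec, dif_pos (show 1 < n from h2), hψ]
            exact hs1 h2
          · have h4 : (i : ℕ) ≠ N := fun h => hN (Fin.ext h)
            have := i.2
            exact absurd ⟨by omega, fun _ => by omega, fun h => absurd h h2⟩ hfree
      · have := i.2
        exact absurd ⟨by omega, fun h => absurd h h1, fun h => by omega⟩ hfree
  have hsum : ∀ j : Fin (n - 2), ∑ i : Fin (N + 1),
      (ψ (formCoeff k r N n i) - f.coeff i) * nodeVal p j ^ (i : ℕ) = 0 := by
    intro j
    have hj := j.2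
    have h1 := congrArg ψ (sum_formCoeff k r N n hn j)
    rw [map_sum, map_pow, sec, dif_pos (by omega), hψ] at h1
    have h2 := hs2 j
    rw [Polynomial.eval_eq_sum_range' (Nat.lt_succ_of_le hf),
      ← Fin.sum_univ_eq_sum_range (fun i => f.coeff i * nodeVal p j ^ i) (N + 1)] at h2
    simp only [map_mul, map_pow, hnode] at h1
    simp only [sub_mul, Finset.sum_sub_distrib]
    rw [h1, ← h2]
    exact sub_self _
  -- The coordinates are prescribed, so only the solved coefficients could differ from those of f.
  -- Both forms take the same values at the n - 2 distinct nonzero nodes, so after dividing by a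
  -- power of the node the differences satisfy a Vandermonde system and vanish.
  let δ : Fin (n - 2) → L := fun l =>
    ψ (formCoeff k r N n ⟨N + 2 - n + l, by have := l.2; omega⟩) - f.coeff (N + 2 - n + l)
  have hδ : δ = 0 := by
    refine Matrix.eq_zero_of_forall_index_sum_mul_pow_eq_zero (nodeVal_injective hp hp1) fun j => ?_
    refine (mul_eq_zero.1 ?_).resolve_left (pow_ne_zero (N + 2 - n) (nodeVal_ne_zero hp0 j))
    rw [← hsum j, Finset.mul_sum]
    refine Finset.sum_bij_ne_zero
      (fun l _ _ => (⟨N + 2 - n + l, by have := l.2; omega⟩ : Fin (N + 1)))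
      (fun _ _ _ => Finset.mem_univ _) ?_ ?_ ?_
    · intro l _ _ l' _ _ h
      have := congrArg Fin.val h
      simp only at this
      exact Fin.ext (by omega)
    · intro i _ hi
      have h : N + 2 - n ≤ (i : ℕ) ∧ (i : ℕ) - (N + 2 - n) < n - 2 := by
        by_contra h
        exact hi (by rw [hknown i h, sub_self, zero_mul])
      have hi' : (⟨N + 2 - n + ((i : ℕ) - (N + 2 - n)), by have := i.2; omega⟩ : Fin (N + 1)) = i :=
        Fin.ext (by simp only; omega)
      refine ⟨⟨(i : ℕ) - (N + 2 - n), h.2⟩, Finset.mem_univ _, ?_, hi'⟩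
      have hv := congrArg Fin.val hi'
      simp only at hv
      have hpow : nodeVal p j ^ (i : ℕ) =
          nodeVal p j ^ (N + 2 - n) * nodeVal p j ^ ((i : ℕ) - (N + 2 - n)) := by
        rw [← pow_add, hv]
      simp only [δ, hv, Fin.eta]
      intro h0
      apply hi
      rw [hpow, ← h0]
      ring
    · intro l _ _
      simp only [δ]
      rw [pow_add]
      ring
  refine ⟨ψ, fun j => hψ _, fun j => hψ _, fun i => ?_⟩
  by_cases h : N + 2 - n ≤ (i : ℕ) ∧ (i : ℕ) - (N + 2 - n) < n - 2
  · have := congrFun hδ ⟨(i : ℕ) - (N + 2 - n), h.2⟩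
    have hv : N + 2 - n + ((i : ℕ) - (N + 2 - n)) = i := by omega
    simp only [δ, hv, Pi.zero_apply, Fin.eta] at this
    exact sub_eq_zero.1 this
  · exact hknown i h


/-! ### Multiplicative independence of the values of the generic form with a double root. -/

theorem sum_emultiplicity_modEq {A ι : Type*} [CommRing A] [IsDomain A] [WfDvdMonoid A]
    [Fintype ι] {π : A} (hπ : Prime π) {b : ι → A} {m : ι → ℕ}
    (hm : ∀ i, emultiplicity π (b i) = m i) {r : ℕ} {y z : A} (hy : y ≠ 0) (hz : z ≠ 0)
    {e e' : ι → ℕ} (h : y ^ r * ∏ i, b i ^ e i = z ^ r * ∏ i, b i ^ e' i) :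
    ∑ i, e i * m i ≡ ∑ i, e' i * m i [MOD r] := by
  have hfin : ∀ a : A, a ≠ 0 → ∃ u : ℕ, emultiplicity π a = u := fun a ha =>
    ⟨_, (FiniteMultiplicity.of_prime_left hπ ha).emultiplicity_eq_multiplicity⟩
  obtain ⟨u, hu⟩ := hfin y hy
  obtain ⟨w, hw⟩ := hfin z hz
  -- The r-th powers of y and z contribute multiples of r to the valuation, so they disappear modulo
  -- r.
  have h1 := congrArg (emultiplicity π) h
  rw [emultiplicity_mul hπ, emultiplicity_mul hπ, emultiplicity_pow hπ, emultiplicity_pow hπ,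
    Finset.emultiplicity_prod hπ, Finset.emultiplicity_prod hπ, hu, hw] at h1
  simp only [emultiplicity_pow hπ, hm] at h1
  norm_cast at h1
  unfold Nat.ModEq
  calc (∑ i, e i * m i) % r = (r * u + ∑ i, e i * m i) % r := by rw [Nat.mul_add_mod]
    _ = (r * w + ∑ i, e' i * m i) % r := by rw [h1]
    _ = _ := by rw [Nat.mul_add_mod]

/-- The value of a form of degree `N` at a point of the projective line, where `none` is the point
at infinity. -/
def pointValue {T : Type*} [CommRing T] (N : ℕ) (f : Polynomial T) : Option T → T
  | none => f.coeff N
  | some a => f.eval a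

/-- The generic form with a double root: the root number `i₁` is replaced by the root number
`i₀`. -/
def doubleRootPoly (F : Type*) [CommRing F] {N : ℕ} (i₀ i₁ : Fin N) : Polynomial (SplitRing F N) :=
  splitPoly (splitLead F N) (MvPolynomial.X ∘ Function.update id i₁ i₀)

/-- The constants in `SplitRing`. -/
def splitConst (F : Type*) [CommRing F] (N : ℕ) : F →+* SplitRing F N :=
  MvPolynomial.C.comp Polynomial.C

section

variable {F : Type*} [Field F] {N : ℕ}

theorem prime_splitLead : Prime (splitLead F N) :=
  (MvPolynomial.prime_C_iff _).2 Polynomial.prime_X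

theorem prime_X_sub_splitConst (i : Fin N) (a : F) :
    Prime (MvPolynomial.X i - splitConst F N a) := by
  refine prime_X_sub i (by simp [splitConst, MvPolynomial.algebraMap_eq]) ?_
  intro h
  have := congrArg (MvPolynomial.coeff (Finsupp.single i 1)) h
  simp [splitConst, MvPolynomial.coeff_C, (Finsupp.single_ne_zero.2 one_ne_zero).symm] at this

theorem splitConst_sub_X_ne_zero (i : Fin N) (a : F) :
    splitConst F N a - MvPolynomial.X i ≠ 0 := by
  rw [← neg_ne_zero, neg_sub]
  exact (prime_X_sub_splitConst i a).ne_zero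

theorem not_splitLead_dvd (i : Fin N) (a : F) :
    ¬ splitLead F N ∣ splitConst F N a - MvPolynomial.X i := by
  intro h
  have := (MvPolynomial.C_dvd_iff_dvd_coeff _ _).1 h (Finsupp.single i 1)
  simp only [splitConst, RingHom.comp_apply, MvPolynomial.coeff_sub, MvPolynomial.coeff_C,
    MvPolynomial.coeff_X] at this
  rw [if_neg (Finsupp.single_ne_zero.2 one_ne_zero).symm, if_pos trivial, zero_sub, dvd_neg] at this
  exact Polynomial.prime_X.not_isUnit (isUnit_of_dvd_one this)

theorem pointValue_doubleRootPoly_some (i₀ i₁ : Fin N) (a : F) :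
    pointValue N (doubleRootPoly F i₀ i₁) (some (splitConst F N a)) = splitLead F N *
      ∏ i, (splitConst F N a - MvPolynomial.X (Function.update id i₁ i₀ i)) :=
  eval_splitPoly _ _ _

theorem pointValue_doubleRootPoly_none (i₀ i₁ : Fin N) :
    pointValue N (doubleRootPoly F i₀ i₁) none = splitLead F N :=
  coeff_splitPoly_last _ _

theorem pointValue_doubleRootPoly_ne_zero (i₀ i₁ : Fin N) (o : Option F) :
    pointValue N (doubleRootPoly F i₀ i₁) (o.map (splitConst F N)) ≠ 0 := by
  cases o with
  | none =>
    rw [Option.map_none, pointValue_doubleRootPoly_none]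
    exact prime_splitLead.ne_zero
  | some a =>
    rw [Option.map_some, pointValue_doubleRootPoly_some]
    exact mul_ne_zero prime_splitLead.ne_zero
      (Finset.prod_ne_zero_iff.2 fun i _ => splitConst_sub_X_ne_zero _ _)

theorem emultiplicity_self_of_prime {A : Type*} [CommRing A] [IsDomain A] [WfDvdMonoid A] {π : A}
    (hπ : Prime π) : emultiplicity π π = 1 := by
  rw [(FiniteMultiplicity.of_prime_left hπ hπ.ne_zero).emultiplicity_self]

theorem emultiplicity_splitLead (i₀ i₁ : Fin N) (o : Option F) :
    emultiplicity (splitLead F N)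
      (pointValue N (doubleRootPoly F i₀ i₁) (o.map (splitConst F N))) = 1 := by
  cases o with
  | none =>
    rw [Option.map_none, pointValue_doubleRootPoly_none]
    exact emultiplicity_self_of_prime prime_splitLead
  | some a =>
    rw [Option.map_some, pointValue_doubleRootPoly_some, emultiplicity_mul prime_splitLead,
      emultiplicity_self_of_prime prime_splitLead, emultiplicity_eq_zero.2, add_zero]
    intro h
    obtain ⟨i, _, hi⟩ := prime_splitLead.exists_mem_finset_dvd h
    exact not_splitLead_dvd _ _ hi

theorem X_sub_splitConst_dvd_iff (i : Fin N) (a : F) (g : SplitRing F N) :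
    (MvPolynomial.X i - splitConst F N a) ∣ g ↔
      MvPolynomial.aeval (Function.update MvPolynomial.X i (splitConst F N a)) g = 0 :=
  X_sub_dvd_iff i (by simp [splitConst, MvPolynomial.algebraMap_eq]) g

theorem not_X_sub_splitConst_dvd {i j : Fin N} {a b : F} (h : i ≠ j ∨ a ≠ b) :
    ¬ (MvPolynomial.X i - splitConst F N a) ∣ splitConst F N b - MvPolynomial.X j := by
  rw [X_sub_splitConst_dvd_iff]
  have h1 : MvPolynomial.aeval (Function.update MvPolynomial.X i (splitConst F N a))
      (splitConst F N b) = splitConst F N b := by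
    simp [splitConst, MvPolynomial.algebraMap_eq]
  rw [map_sub, h1, MvPolynomial.aeval_X]
  by_cases hij : j = i
  · rw [hij, Function.update_self, ← map_sub, map_eq_zero]
    rcases h with h | h
    · exact absurd hij.symm h
    · exact sub_ne_zero.2 h.symm
  · rw [Function.update_of_ne hij]
    exact splitConst_sub_X_ne_zero _ _

theorem not_X_sub_splitConst_dvd_splitLead (i : Fin N) (a : F) :
    ¬ (MvPolynomial.X i - splitConst F N a) ∣ splitLead F N := by
  rw [X_sub_splitConst_dvd_iff]
  have h1 : MvPolynomial.aeval (Function.update MvPolynomial.X i (splitConst F N a))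
      (splitLead F N) = splitLead F N := by
    simp [splitLead, MvPolynomial.algebraMap_eq]
  rw [h1]
  exact prime_splitLead.ne_zero

-- The root number i₂ remains simple after the identification of i₁ with i₀. Hence X i₂ - a divides
-- the value at a exactly once and no value at another point.
open Classical in
theorem emultiplicity_X_sub_splitConst {i₀ i₁ i₂ : Fin N} (h20 : i₂ ≠ i₀) (h21 : i₂ ≠ i₁) (a : F)
    (o : Option F) : emultiplicity (MvPolynomial.X i₂ - splitConst F N a)
      (pointValue N (doubleRootPoly F i₀ i₁) (o.map (splitConst F N))) =
        ((if o = some a then 1 else 0 : ℕ) : ℕ∞) := by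
  have hp := prime_X_sub_splitConst i₂ a
  cases o with
  | none =>
    rw [Option.map_none, pointValue_doubleRootPoly_none, if_neg (by simp), Nat.cast_zero,
      emultiplicity_eq_zero]
    exact not_X_sub_splitConst_dvd_splitLead _ _
  | some b =>
    rw [Option.map_some, pointValue_doubleRootPoly_some]
    by_cases hab : b = a
    · subst hab
      have hu : ∀ i ∈ ({i₂} : Finset (Fin N))ᶜ, i₂ ≠ Function.update id i₁ i₀ i := by
        intro i hi
        rw [Finset.mem_compl, Finset.mem_singleton] at hi
        by_cases h : i = i₁
        · subst h; simpa using h20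
        · simpa [h] using Ne.symm hi
      have hs : splitConst F N b - MvPolynomial.X i₂ =
          -(MvPolynomial.X i₂ - splitConst F N b) := by ring
      rw [if_pos rfl, ← Finset.prod_mul_prod_compl ({i₂} : Finset (Fin N)), Finset.prod_singleton,
        Function.update_of_ne h21, id, emultiplicity_mul hp, emultiplicity_mul hp, hs,
        emultiplicity_neg, emultiplicity_self_of_prime hp, emultiplicity_eq_zero.2,
        emultiplicity_eq_zero.2]
      · simp
      · intro h
        obtain ⟨i, hi, hd⟩ := hp.exists_mem_finset_dvd h
        exact not_X_sub_splitConst_dvd (Or.inl (hu i hi)) hd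
      · exact not_X_sub_splitConst_dvd_splitLead _ _
    · rw [if_neg (by simpa using hab), Nat.cast_zero, emultiplicity_eq_zero]
      intro h
      rcases hp.dvd_or_dvd h with h | h
      · exact not_X_sub_splitConst_dvd_splitLead _ _ h
      · obtain ⟨i, _, hd⟩ := hp.exists_mem_finset_dvd h
        exact not_X_sub_splitConst_dvd (Or.inr (Ne.symm hab)) hd

/-- The values of the generic form with a double root at distinct points of the projective line are
multiplicatively independent modulo `r`-th powers. -/
theorem exponents_eq_of_pointValue {ι : Type*} [Fintype ι] {i₀ i₁ i₂ : Fin N} (h20 : i₂ ≠ i₀)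
    (h21 : i₂ ≠ i₁) {pt : ι → Option F} (hpt : Function.Injective pt) {r : ℕ}
    {y z : SplitRing F N} (hy : y ≠ 0) (hz : z ≠ 0) (e e' : ι → Fin r)
    (h : y ^ r * ∏ i, pointValue N (doubleRootPoly F i₀ i₁) ((pt i).map (splitConst F N)) ^ (e i : ℕ) =
      z ^ r * ∏ i, pointValue N (doubleRootPoly F i₀ i₁) ((pt i).map (splitConst F N)) ^ (e' i : ℕ)) :
    e = e' := by
  classical
  have hsome : ∀ i, pt i ≠ none → e i = e' i := by
    intro i hi
    obtain ⟨a, ha⟩ := Option.ne_none_iff_exists'.1 hi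
    have := sum_emultiplicity_modEq (prime_X_sub_splitConst i₂ a)
      (fun j => emultiplicity_X_sub_splitConst h20 h21 a (pt j)) hy hz h
    have hif : ∀ j, (pt j = some a) ↔ j = i := fun j =>
      ⟨fun h => hpt (h.trans ha.symm), fun h => h ▸ ha⟩
    simp only [hif, mul_ite, mul_one, mul_zero, Finset.sum_ite_eq', Finset.mem_univ, if_true]
      at this
    exact Fin.ext (Nat.ModEq.eq_of_lt_of_lt this (e i).2 (e' i).2)
  funext i
  by_cases hi : pt i = none
  · have := sum_emultiplicity_modEq (m := fun _ => 1) prime_splitLead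
      (fun j => by rw [emultiplicity_splitLead, Nat.cast_one]) hy hz h
    simp only [mul_one] at this
    rw [← Finset.add_sum_erase _ _ (Finset.mem_univ i),
      ← Finset.add_sum_erase _ (fun j => (e' j : ℕ)) (Finset.mem_univ i)] at this
    have hrest : ∑ j ∈ Finset.univ.erase i, (e j : ℕ) = ∑ j ∈ Finset.univ.erase i, (e' j : ℕ) := by
      refine Finset.sum_congr rfl fun j hj => ?_
      rw [hsome j fun h => Finset.ne_of_mem_erase hj (hpt (h.trans hi.symm))]
    rw [hrest] at this
    exact Fin.ext (Nat.ModEq.eq_of_lt_of_lt (Nat.ModEq.add_right_cancel' _ this) (e i).2 (e' i).2)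
  · exact hsome i hi

/-- Monomials in `r`-th roots of the values of the generic form with a double root at distinct
points are linearly independent. -/
theorem linearIndependent_roots_pointValue {E ι : Type*} [IsAlgClosed F] [Field E]
    [Algebra (FractionRing (SplitRing F N)) E] [IsGalois (FractionRing (SplitRing F N)) E]
    [Fintype ι] {i₀ i₁ i₂ : Fin N} (h20 : i₂ ≠ i₀) (h21 : i₂ ≠ i₁)
    {pt : ι → Option F} (hpt : Function.Injective pt) {r : ℕ} (hr : 0 < r) {s : ι → E}
    (hs : ∀ i, s i ^ r = algebraMap (FractionRing (SplitRing F N)) E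
      (algebraMap (SplitRing F N) (FractionRing (SplitRing F N))
        (pointValue N (doubleRootPoly F i₀ i₁) ((pt i).map (splitConst F N))))) :
    LinearIndependent (FractionRing (SplitRing F N))
      (fun e : ι → Fin r => ∏ i, s i ^ (e i : ℕ)) := by
  set K := FractionRing (SplitRing F N)
  have hKinj : Function.Injective (algebraMap (SplitRing F N) K) := IsFractionRing.injective _ _
  have hinj : Function.Injective (algebraMap K E) := (algebraMap K E).injective
  have hs0 : ∀ i, s i ≠ 0 := by
    intro i h
    have := hs i
    rw [h, zero_pow hr.ne', eq_comm, map_eq_zero_iff _ hinj, map_eq_zero_iff _ hKinj] at this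
    exact pointValue_doubleRootPoly_ne_zero _ _ _ this
  refine linearIndependent_kummer_monomials ?_ s hs0 (fun i => ⟨_, (hs i).symm⟩) ?_
  · intro ω hω
    let j : F →+* K := (algebraMap (SplitRing F N) K).comp (splitConst F N)
    have hsplit : (Polynomial.X ^ r - 1 : Polynomial F).Splits := IsAlgClosed.splits _
    obtain ⟨a, ha⟩ := hsplit.mem_range_of_isRoot (i := (algebraMap K E).comp j) (x := ω)
      (Polynomial.X_pow_sub_C_ne_zero hr 1) (by simp [hω])
    exact ⟨j a, ha⟩
  · intro e e' x h
    -- A proportionality of monomials, cleared of denominators and raised to the r-th power, becomes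
    -- an identity between the values themselves.
    obtain ⟨z, y, hy, rfl⟩ := IsFractionRing.div_surjective (A := SplitRing F N) x
    have hy0 : y ≠ 0 := nonZeroDivisors.ne_zero hy
    have hyE : algebraMap K E (algebraMap _ K y) ≠ 0 := by
      rw [Ne, map_eq_zero_iff _ hinj, map_eq_zero_iff _ hKinj]; exact hy0
    have h1 : algebraMap K E (algebraMap _ K y) * ∏ i, s i ^ (e i : ℕ) =
        algebraMap K E (algebraMap _ K z) * ∏ i, s i ^ (e' i : ℕ) := by
      rw [h, map_div₀, ← mul_assoc, mul_div_cancel₀ _ hyE]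
    have hz0 : z ≠ 0 := by
      rintro rfl
      rw [map_zero, map_zero, zero_mul] at h1
      exact mul_ne_zero hyE (Finset.prod_ne_zero_iff.2 fun i _ => pow_ne_zero _ (hs0 i)) h1
    refine exponents_eq_of_pointValue h20 h21 hpt hy0 hz0 e e' (hKinj (hinj ?_))
    have h2 := congrArg (· ^ r) h1
    simp only [mul_pow, ← Finset.prod_pow, ← pow_mul] at h2
    simp only [mul_comm _ r] at h2
    simp only [pow_mul, hs] at h2
    simpa only [map_mul, map_pow, map_prod] using h2

end


/-! ### Functions on 𝔸_{r,n} as polynomials in the sⱼ. -/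

/-- The map that evaluates a polynomial in the coefficients and in the points `p₁, …, p_{n-3}` on
the form over `𝔸_{r,n}`. -/
def coeffHom (k : Type*) [Field k] (r N n : ℕ) :
    MvPolynomial (Fin (N + 1)) (MvPolynomial (Fin (n - 3)) k) →+* CoordRing k N n :=
  MvPolynomial.eval₂Hom
    (MvPolynomial.aeval fun j => coordFun k N n (Coord.p j) :
      MvPolynomial (Fin (n - 3)) k →ₐ[k] CoordRing k N n).toRingHom
    (formCoeff k r N n)

section

variable {k : Type*} [Field k] {r N n : ℕ}

theorem coeffHom_X (i : Fin (N + 1)) :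
    coeffHom k r N n (MvPolynomial.X i) = formCoeff k r N n i := by
  simp [coeffHom]

theorem coeffHom_C_X (j : Fin (n - 3)) :
    coeffHom k r N n (MvPolynomial.C (MvPolynomial.X j)) = coordFun k N n (Coord.p j) := by
  simp [coeffHom]

theorem coeffHom_C_C (a : k) :
    coeffHom k r N n (MvPolynomial.C (MvPolynomial.C a)) = algebraMap k (CoordRing k N n) a := by
  simp [coeffHom]

/-- Used to push divisibility by the discriminant forward to divisibility by `Phi`. -/
theorem coeffHom_comp_map : (coeffHom k r N n).comp
    (MvPolynomial.map (algebraMap k (MvPolynomial (Fin (n - 3)) k))) = pullFun k r N n := by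
  refine MvPolynomial.ringHom_ext (fun a => ?_) fun i => ?_
  · rw [RingHom.comp_apply, MvPolynomial.map_C, MvPolynomial.algebraMap_eq, coeffHom_C_C]
    simp [pullFun]
  · rw [RingHom.comp_apply, MvPolynomial.map_X, coeffHom_X]
    simp [pullFun]

theorem node_mem_range_coeffHom (j : Fin (n - 2)) : node k N n j ∈ (coeffHom k r N n).range := by
  rw [node]
  split_ifs
  · exact one_mem _
  · exact ⟨_, coeffHom_C_X _⟩

/-- The r-th power of a section coordinate is the value of the form at the corresponding point,
hence polynomial in the coefficients and the points. -/
theorem coord_s_pow_mem_range_coeffHom (hn : n ≤ N + 1) (j : Fin n) :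
    coordFun k N n (Coord.s j) ^ r ∈ (coeffHom k r N n).range := by
  have hsec : coordFun k N n (Coord.s j) = sec k N n j := by rw [sec, dif_pos j.2]
  have hj := j.2
  rw [hsec]
  by_cases h0 : (j : ℕ) = 0
  · rw [h0, ← formCoeff_last k r N n (by omega) hn]
    exact ⟨_, coeffHom_X _⟩
  · by_cases h1 : (j : ℕ) = 1
    · rw [h1, ← formCoeff_zero k r N n (by omega) hn]
      exact ⟨_, coeffHom_X _⟩
    · have h2 : (j : ℕ) = (⟨(j : ℕ) - 2, by omega⟩ : Fin (n - 2)) + 2 := by simp only; omega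
      rw [h2, ← sum_formCoeff k r N n hn]
      exact sum_mem fun i _ => mul_mem ⟨_, coeffHom_X i⟩ (pow_mem (node_mem_range_coeffHom _) _)

/-- Up to the denominators, the functions on `𝔸_{r,n}` are combinations of the monomials in the
`s_j` of exponents `< r` with coefficients that are polynomials in the `a_i` and `p_j`. -/
theorem exists_sum_coeffHom (hr : 0 < r) (hn : n ≤ N + 1) (z : MvPolynomial (Coord N n) k) :
    ∃ G : (Fin n → Fin r) → MvPolynomial (Fin (N + 1)) (MvPolynomial (Fin (n - 3)) k),
      algebraMap _ (CoordRing k N n) z =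
        ∑ e, coeffHom k r N n (G e) * ∏ j, coordFun k N n (Coord.s j) ^ (e j : ℕ) := by
  set S := (coeffHom k r N n).range with hS
  let v : (Fin n → Fin r) → CoordRing k N n := fun e => ∏ j, coordFun k N n (Coord.s j) ^ (e j : ℕ)
  let T : Submodule S (CoordRing k N n) := Submodule.span S (Set.range v)
  have hsmul : ∀ a ∈ S, ∀ x ∈ T, a * x ∈ T := fun a ha x hx => T.smul_mem ⟨a, ha⟩ hx
  have hmon : ∀ m : Fin n → ℕ, ∏ j, coordFun k N n (Coord.s j) ^ m j ∈ T := by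
    intro m
    have : ∏ j, coordFun k N n (Coord.s j) ^ m j =
        (∏ j, (coordFun k N n (Coord.s j) ^ r) ^ (m j / r)) *
          v fun j => ⟨m j % r, Nat.mod_lt _ hr⟩ := by
      simp only [v]
      rw [← Finset.prod_mul_distrib]
      refine Finset.prod_congr rfl fun j _ => ?_
      rw [← pow_mul, ← pow_add, Nat.div_add_mod]
    rw [this]
    exact hsmul _ (prod_mem fun j _ => pow_mem (coord_s_pow_mem_range_coeffHom hn j) _) _
      (Submodule.subset_span ⟨_, rfl⟩)
  -- The extra monomial is carried along so that, in the induction, multiplication by a section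
  -- coordinate only shifts its exponent.
  have hmem : ∀ m : Fin n → ℕ, algebraMap _ (CoordRing k N n) z *
      ∏ j, coordFun k N n (Coord.s j) ^ m j ∈ T := by
    induction z using MvPolynomial.induction_on with
    | C a =>
      intro m
      refine hsmul _ ⟨_, (coeffHom_C_C a).trans ?_⟩ _ (hmon m)
      rw [← MvPolynomial.algebraMap_eq, ← IsScalarTower.algebraMap_apply]
    | add p q hp hq =>
      intro m
      rw [map_add, add_mul]
      exact T.add_mem (hp m) (hq m)
    | mul_X p c hp =>
      intro m
      rw [map_mul]
      change _ * coordFun k N n c * _ ∈ T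
      cases c with
      | a i =>
        rw [mul_comm _ (coordFun k N n _), mul_assoc]
        exact hsmul _ ⟨_, (coeffHom_X ⟨i, Nat.lt_succ_of_le i.2.1⟩).trans
          (formCoeff_free k r N n hn _ i.2)⟩ _ (hp m)
      | p j =>
        rw [mul_comm _ (coordFun k N n _), mul_assoc]
        exact hsmul _ ⟨_, coeffHom_C_X j⟩ _ (hp m)
      | s j =>
        have h := hp (fun i => m i + if i = j then 1 else 0)
        simp only [pow_add, Finset.prod_mul_distrib, pow_ite, pow_one, pow_zero,
          Finset.prod_ite_eq', Finset.mem_univ, if_true] at h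
        rwa [mul_assoc, mul_comm (coordFun k N n (Coord.s j))]
  have h1 := hmem 0
  simp only [Pi.zero_apply, pow_zero, Finset.prod_const_one, mul_one] at h1
  obtain ⟨c, hc⟩ := (Submodule.mem_span_range_iff_exists_fun S).1 h1
  choose G hG using fun e => (c e).2
  refine ⟨G, ?_⟩
  rw [← hc]
  exact Finset.sum_congr rfl fun e _ => by rw [hG]; rfl

end

/-! ### Integrality of a principal closed subscheme. -/

/-- The inverse image of a principal closed subscheme is integral if its equation is prime. -/
theorem isIntegral_pullback_of_prime.{u} {A B : Type u} [CommRing A] [CommRing B] (φ : A →+* B) {x : A}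
    (h : Prime (φ x)) : IsIntegral (pullback (Spec.map (CommRingCat.ofHom φ))
      (Spec.map (CommRingCat.ofHom (Ideal.Quotient.mk (Ideal.span {x}))))) := by
  let _ : Algebra A B := φ.toAlgebra
  have hI : (Ideal.span {x}).map (algebraMap A B) = Ideal.span {φ x} := by
    rw [Ideal.map_span, Set.image_singleton]
    rfl
  have : ((Ideal.span {x}).map (algebraMap A B)).IsPrime := by
    rw [hI]
    exact (Ideal.span_singleton_prime h.ne_zero).2 h
  have : IsDomain (TensorProduct A B (A ⧸ Ideal.span {x})) :=
    (Algebra.TensorProduct.quotIdealMapEquivTensorQuot B (Ideal.span {x})).symm.toMulEquiv.isDomain _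
  have : IsDomain (CommRingCat.of (TensorProduct A B (A ⧸ Ideal.span {x}))) := this
  exact IsIntegral.of_isIso (pullbackSpecIso A B (A ⧸ Ideal.span {x})).inv


/-! ### The generic point of the discriminant locus. -/

/-- The points `∞, 0, 1, p₁, …, p_{n-3}` of the projective line. -/
def sectionPoint {L : Type*} [Zero L] [One L] {n : ℕ} (p : Fin (n - 3) → L) (j : Fin n) :
    Option L :=
  if (j : ℕ) = 0 then none
  else if h1 : 2 ≤ (j : ℕ) then some (nodeVal p ⟨(j : ℕ) - 2, by have := j.2; omega⟩)
  else some 0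

theorem sectionPoint_injective {L : Type*} [Field L] {n : ℕ} {p : Fin (n - 3) → L}
    (hp : Function.Injective p) (hp0 : ∀ j, p j ≠ 0) (hp1 : ∀ j, p j ≠ 1) :
    Function.Injective (sectionPoint p) := by
  intro i j h
  unfold sectionPoint at h
  split_ifs at h with h1 h2 h3 h4 h5 h6 h7
  · exact Fin.ext (h1.trans h2.symm)
  · have := congrArg Fin.val (nodeVal_injective hp hp1 (Option.some.inj h))
    simp only at this
    exact Fin.ext (by omega)
  · exact absurd (Option.some.inj h) (nodeVal_ne_zero hp0 _)
  · exact absurd (Option.some.inj h).symm (nodeVal_ne_zero hp0 _)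
  · exact Fin.ext (by omega)

/-- A variant of `exists_specialization` in terms of the values at the points of the sections. -/
theorem exists_specialization_of_pointValue {k L : Type*} [Field k] [Field L] [Algebra k L]
    {r N n : ℕ} (hn : n ≤ N + 1) {f : Polynomial L} (hf : f.natDegree ≤ N) {p : Fin (n - 3) → L}
    (hp : Function.Injective p) (hp0 : ∀ j, p j ≠ 0) (hp1 : ∀ j, p j ≠ 1) {s : Fin n → L}
    (hs : ∀ j, s j ^ r = pointValue N f (sectionPoint p j)) :
    ∃ ψ : CoordRing k N n →ₐ[k] L, (∀ j, ψ (coordFun k N n (Coord.p j)) = p j) ∧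
      (∀ j, ψ (coordFun k N n (Coord.s j)) = s j) ∧
      ∀ i, ψ (formCoeff k r N n i) = f.coeff i := by
  refine exists_specialization hn hf hp hp0 hp1 (fun h => ?_) (fun h => ?_) fun j => ?_
  · rw [hs]; rfl
  · rw [hs, Polynomial.coeff_zero_eq_eval_zero]; rfl
  · rw [hs, sectionPoint, if_neg (by simp), dif_pos (by simp)]; rfl

theorem map_pullFun_genericPoly {k L : Type*} [Field k] [Field L] [Algebra k L] {r N n : ℕ}
    (ψ : CoordRing k N n →ₐ[k] L) {f : Polynomial L} (hf : f.natDegree ≤ N)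
    (h : ∀ i, ψ (formCoeff k r N n i) = f.coeff i) :
    (genericPoly k N).map ((ψ : CoordRing k N n →+* L).comp (pullFun k r N n)) = f :=
  map_genericPoly _ hf fun i => by simp [pullFun, h]

/-- It is enough to find one point where the form has distinct roots. Over an algebraically closed
field any monic form with N distinct roots lifts, since the r-th roots of its values exist. -/
theorem Phi_ne_zero {k L : Type*} [Field k] [Field L] [Algebra k L] [IsAlgClosed L] {r N n : ℕ}
    (hr : 0 < r) (hN : 0 < N) (hn : n ≤ N + 1) {p : Fin (n - 3) → L}
    (hp : Function.Injective p) (hp0 : ∀ j, p j ≠ 0) (hp1 : ∀ j, p j ≠ 1) : Phi k r N n ≠ 0 := by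
  let x : Fin N → L := fun i => Infinite.natEmbedding L i
  have hx : Function.Injective x := fun i j h => Fin.ext ((Infinite.natEmbedding L).injective h)
  choose s hs using fun j : Fin n => IsAlgClosed.exists_pow_nat_eq
    (pointValue N (splitPoly 1 x) (sectionPoint p j)) hr
  obtain ⟨ψ, -, -, hψ⟩ := exists_specialization_of_pointValue (k := k) hn
    (natDegree_splitPoly_le 1 x) hp hp0 hp1 hs
  have hd := map_binaryDiscr_of_split hN _ one_ne_zero x
    (map_pullFun_genericPoly ψ (natDegree_splitPoly_le 1 x) hψ)
  intro h0
  have h1 : ((ψ : CoordRing k N n →+* L).comp (pullFun k r N n)) (binaryDiscr k N) = 0 := by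
    rw [RingHom.comp_apply]
    exact (congrArg ψ h0).trans (map_zero ψ)
  have h2 := pow_ne_zero 2 (diffProd_ne_zero hx)
  rw [h1] at hd
  rcases hd with h | h
  · exact h2 (by simpa using h.symm)
  · exact h2 (by simpa using h.symm)

/-- The map of the rings of the generic split polynomial induced by a map of ground rings. -/
def splitMap {R R' : Type*} [CommRing R] [CommRing R'] (ι : R →+* R') (N : ℕ) :
    SplitRing R N →+* SplitRing R' N :=
  MvPolynomial.map (Polynomial.mapRingHom ι)

theorem splitMap_injective {R R' : Type*} [CommRing R] [CommRing R'] {ι : R →+* R'} {N : ℕ}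
    (hι : Function.Injective ι) : Function.Injective (splitMap ι N) :=
  MvPolynomial.map_injective _ (Polynomial.map_injective ι hι)

theorem splitMap_splitConst {R R' : Type*} [CommRing R] [CommRing R'] (ι : R →+* R') (N : ℕ)
    (a : R) : splitMap ι N (splitConst R N a) = splitConst R' N (ι a) := by
  simp [splitMap, splitConst]

theorem splitMap_splitLead {R R' : Type*} [CommRing R] [CommRing R'] (ι : R →+* R') (N : ℕ) :
    splitMap ι N (splitLead R N) = splitLead R' N := by
  simp [splitMap, splitLead]

theorem splitMap_X {R R' : Type*} [CommRing R] [CommRing R'] (ι : R →+* R') {N : ℕ}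
    (i : Fin N) : splitMap ι N (MvPolynomial.X i) = MvPolynomial.X i := by
  simp [splitMap]

/-- `Φ_{r,g,n}` generates the kernel of a map to a field. -/
theorem exists_forall_eq_zero_iff_Phi_dvd.{u} {k : Type u} [Field k] {r N n : ℕ} (hr : 0 < r)
    (hN : 3 ≤ N) (hn : n ≤ N + 1) (hrk : (r : k) ≠ 0) (h2 : (2 : k) ≠ 0)
    {F : Type u} [Field F] [IsAlgClosed F] (ι : MvPolynomial (Fin (n - 3)) k →+* F)
    (hι : Function.Injective ι) :
    ∃ (E : Type u) (_ : Field E) (ψ : CoordRing k N n →+* E), ∀ z, ψ z = 0 ↔ Phi k r N n ∣ z := by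
  let i₀ : Fin N := ⟨0, by omega⟩
  let i₁ : Fin N := ⟨1, by omega⟩
  let i₂ : Fin N := ⟨2, by omega⟩
  have h01 : i₀ ≠ i₁ := by simp [i₀, i₁]
  have h20 : i₂ ≠ i₀ := by simp [i₀, i₂]
  have h21 : i₂ ≠ i₁ := by simp [i₁, i₂]
  let A := SplitRing F N
  let K := FractionRing A
  let E := SeparableClosure K
  let κ : A →+* E := (algebraMap K E).comp (algebraMap A K)
  have hκ : Function.Injective κ := (algebraMap K E).injective.comp (IsFractionRing.injective A K)
  let κF : F →+* E := κ.comp (splitConst F N)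
  let _ : Algebra k E := ((κF.comp ι).comp MvPolynomial.C).toAlgebra
  let p : Fin (n - 3) → F := fun j => ι (MvPolynomial.X j)
  have hp : Function.Injective p := fun i j h => MvPolynomial.X_injective (hι h)
  have hp0 : ∀ j, p j ≠ 0 := fun j h =>
    MvPolynomial.X_ne_zero j (hι (h.trans (map_zero ι).symm))
  have hp1 : ∀ j, p j ≠ 1 := fun j h => by
    have h1 := hι (h.trans (map_one ι).symm)
    have h3 := congrArg (MvPolynomial.coeff (Finsupp.single j 1)) h1
    rw [MvPolynomial.coeff_X, MvPolynomial.coeff_one,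
      if_neg (Finsupp.single_ne_zero.2 one_ne_zero).symm] at h3
    simp at h3
  have hrE : NeZero (r : E) := ⟨by
    rw [← map_natCast (algebraMap k E), Ne, map_eq_zero]
    exact hrk⟩
  let f := (doubleRootPoly F i₀ i₁).map κ
  have hfs : f = splitPoly (κ (splitLead F N))
      (κ ∘ (MvPolynomial.X ∘ Function.update id i₁ i₀)) := map_splitPoly _ _ _
  have hf : f.natDegree ≤ N := by rw [hfs]; exact natDegree_splitPoly_le _ _
  have hpt : ∀ j : Fin n, pointValue N f (sectionPoint (κF ∘ p) j) =
      κ (pointValue N (doubleRootPoly F i₀ i₁) ((sectionPoint p j).map (splitConst F N))) := by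
    intro j
    unfold sectionPoint
    split_ifs
    · exact Polynomial.coeff_map κ N
    · rw [← map_nodeVal κF]
      exact Polynomial.eval_map_apply (p := doubleRootPoly F i₀ i₁) κ (splitConst F N _)
    · rw [← map_zero κF]
      exact Polynomial.eval_map_apply (p := doubleRootPoly F i₀ i₁) κ (splitConst F N 0)
  choose s hs using fun j : Fin n => IsSepClosed.exists_pow_nat_eq
    (pointValue N f (sectionPoint (κF ∘ p) j)) r
  have hli := linearIndependent_roots_pointValue (E := E) h20 h21
    (sectionPoint_injective hp hp0 hp1) hr (fun j => (hs j).trans (hpt j))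
  obtain ⟨ψ, hψp, hψs, hψ⟩ := exists_specialization_of_pointValue (k := k) hn hf
    (κF.injective.comp hp) (fun j => (map_ne_zero κF).2 (hp0 j))
    (fun j h => hp1 j (κF.injective (h.trans (map_one κF).symm))) hs
  have hzero : ψ (Phi k r N n) = 0 := by
    have hd := map_binaryDiscr_of_split (by omega)
      ((ψ : CoordRing k N n →+* E).comp (pullFun k r N n))
      ((map_ne_zero_iff κ hκ).2 prime_splitLead.ne_zero) _
      ((map_pullFun_genericPoly ψ hf hψ).trans hfs)
    have h0 : diffProd (κ ∘ (MvPolynomial.X ∘ Function.update id i₁ i₀)) = 0 := by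
      rw [diffProd, ← Matrix.det_vandermonde]
      exact Matrix.det_vandermonde_eq_zero_iff.2 ⟨i₀, i₁, by simp [h01], h01⟩
    rw [h0] at hd
    rcases hd with h | h
    · exact h.trans (by simp)
    · exact h.trans (by simp)
  let μ : SplitRing (MvPolynomial (Fin (n - 3)) k) N →+* A := splitMap ι N
  have hμ : Function.Injective μ := splitMap_injective hι
  -- On polynomials in the coefficients and points, ψ is evaluation at the generic form with a
  -- double root. As κ and μ are injective, vanishing under ψ becomes exactly the diagonal condition
  -- of `binaryDiscr_dvd`.
  have hcomp : ∀ G, ψ (coeffHom k r N n G) = κ (μ (MvPolynomial.rename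
      (Function.update id i₁ i₀) (rootHom (MvPolynomial (Fin (n - 3)) k) N G))) := by
    have hC : ∀ a, MvPolynomial.rename (Function.update id i₁ i₀)
        (rootHom (MvPolynomial (Fin (n - 3)) k) N (MvPolynomial.C a)) =
          splitConst _ N a := by
      intro a
      rw [rename_rootHom, ← MvPolynomial.algebraMap_eq, AlgHom.commutes]
      rfl
    have hring : (ψ : CoordRing k N n →+* E).comp (coeffHom k r N n) =
        κ.comp (μ.comp ((MvPolynomial.rename (Function.update id i₁ i₀)).toRingHom.comp
          (rootHom (MvPolynomial (Fin (n - 3)) k) N).toRingHom)) := by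
      refine MvPolynomial.ringHom_ext' (MvPolynomial.ringHom_ext (fun a => ?_) fun j => ?_)
        fun i => ?_
      · change ψ (coeffHom k r N n (MvPolynomial.C (MvPolynomial.C a))) = κ (μ _)
        rw [coeffHom_C_C, AlgHom.commutes]
        exact (congrArg κ ((congrArg μ (hC (MvPolynomial.C a))).trans (splitMap_splitConst ι N _))).symm
      · change ψ (coeffHom k r N n (MvPolynomial.C (MvPolynomial.X j))) = κ (μ _)
        rw [coeffHom_C_X, hψp]
        exact (congrArg κ ((congrArg μ (hC (MvPolynomial.X j))).trans (splitMap_splitConst ι N _))).symm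
      · change ψ (coeffHom k r N n (MvPolynomial.X i)) = κ (μ (MvPolynomial.rename _ _))
        rw [coeffHom_X, hψ, Polynomial.coeff_map]
        congr 1
        refine Eq.trans ?_ (congrArg μ (rename_rootHom _ N _ (MvPolynomial.X i))).symm
        rw [MvPolynomial.aeval_X, ← Polynomial.coeff_map, map_splitPoly, doubleRootPoly]
        congr 2
        · exact (splitMap_splitLead ι N).symm
        · funext j
          exact (splitMap_X ι _).symm
    exact fun G => DFunLike.congr_fun hring G
  refine ⟨E, inferInstance, ψ, fun z => ⟨fun hz => ?_, ?_⟩⟩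
  -- Clearing the denominator multiplies z by a unit, which does not affect divisibility.
  · obtain ⟨⟨z₀, w⟩, hw⟩ := IsLocalization.surj (Submonoid.powers (badLocus k N n)) z
    have hwu : IsUnit (algebraMap _ (CoordRing k N n) (w : MvPolynomial (Coord N n) k)) :=
      IsLocalization.map_units _ w
    rw [← hwu.dvd_mul_right, hw]
    obtain ⟨G, hG⟩ := exists_sum_coeffHom hr hn z₀
    have h3 := congrArg ψ (hw.trans hG)
    have hz' : ψ z = 0 := hz
    simp only [map_mul, hz', zero_mul, map_sum, map_prod, map_pow, hψs, hcomp] at h3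
    have h4 := Fintype.linearIndependent_iff.1 hli
      (fun e => algebraMap A K (μ (MvPolynomial.rename (Function.update id i₁ i₀)
        (rootHom (MvPolynomial (Fin (n - 3)) k) N (G e)))))
      ((Finset.sum_congr rfl fun e _ => Algebra.smul_def _ _).trans h3.symm)
    rw [hG]
    refine Finset.dvd_sum fun e _ => Dvd.dvd.mul_right ?_ _
    have h5 := h4 e
    rw [map_eq_zero_iff _ (IsFractionRing.injective A K), map_eq_zero_iff _ hμ] at h5
    have h6 := map_dvd (coeffHom k r N n) (binaryDiscr_dvd h2 h01 h5)
    rwa [← RingHom.comp_apply, coeffHom_comp_map] at h6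
  · rintro ⟨y, rfl⟩
    change ψ _ = 0
    rw [map_mul, hzero, zero_mul]

/-! ### Primality, irreducibility and the main theorem. -/

theorem prime_Phi {k : Type*} [Field k] {r N n : ℕ} (hr : 0 < r) (hN : 3 ≤ N) (hn : n ≤ N + 1)
    (hrk : (r : k) ≠ 0) (h2 : (2 : k) ≠ 0) : Prime (Phi k r N n) := by
  let R := MvPolynomial (Fin (n - 3)) k
  let F := AlgebraicClosure (FractionRing R)
  let ι : R →+* F := (algebraMap (FractionRing R) F).comp (algebraMap R (FractionRing R))
  have hι : Function.Injective ι :=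
    (algebraMap (FractionRing R) F).injective.comp (IsFractionRing.injective R _)
  obtain ⟨E, _, ψ, hψ⟩ := exists_forall_eq_zero_iff_Phi_dvd hr hN hn hrk h2 ι hι
  have h0 : Phi k r N n ≠ 0 := by
    let _ : Algebra k F := (ι.comp MvPolynomial.C).toAlgebra
    refine Phi_ne_zero (L := F) hr (by omega) hn (p := fun j => ι (MvPolynomial.X j))
      (fun i j h => MvPolynomial.X_injective (hι h))
      (fun j h => MvPolynomial.X_ne_zero j (hι (h.trans (map_zero ι).symm))) fun j h => ?_
    have h1 := congrArg MvPolynomial.totalDegree (hι (h.trans (map_one ι).symm))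
    simp at h1
  refine ⟨h0, fun hu => ?_, fun a b hab => ?_⟩
  · exact (hu.map ψ).ne_zero ((hψ _).2 dvd_rfl)
  · rw [← hψ, map_mul, mul_eq_zero, hψ, hψ] at hab
    exact hab

theorem irreducible_Phi {k : Type*} [Field k] {r N n : ℕ} (h : Prime (Phi k r N n)) :
    Irreducible (Phi k r N n) := by
  have hbad : badLocus k N n ≠ 0 := by
    intro h0
    have h1 : algebraMap (MvPolynomial (Coord N n) k) (CoordRing k N n) (badLocus k N n) = 0 :=
      (congrArg _ h0).trans (map_zero _)
    exact h.ne_zero (eq_zero_of_zero_eq_one (isUnit_zero_iff.1 (h1 ▸ isUnit_badLocus k N n)) _)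
  have : IsDomain (CoordRing k N n) :=
    IsLocalization.isDomain_localization (powers_le_nonZeroDivisors_of_noZeroDivisors hbad)
  exact h.irreducible

end CyclicCovers

end

theorem mainTheorem10 {k : Type*} [Field k] (r g d n : ℕ) (hr : 2 ≤ r) (hg : 2 ≤ g)
    (hd : r * (r - 1) * d + 2 = 2 * g + 2 * r) (hchar : ¬ ringChar k ∣ 2 * r * d)
    (hn : n ≤ r * d + 1) :
    AlgebraicGeometry.IsIntegral (CyclicCovers.Delta k r (r * d) n) ∧
      Irreducible (CyclicCovers.Phi k r (r * d) n) := by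
  -- The relation reads (r - 1)·N = 2(r - 1) + 2g, so N > 2 because g > 0.
  have hN : 3 ≤ r * d := by
    obtain ⟨m, rfl⟩ : ∃ m, r = m + 2 := ⟨r - 2, by omega⟩
    have h1 : (m + 2) * (m + 2 - 1) * d = (m + 1) * ((m + 2) * d) := by
      rw [show m + 2 - 1 = m + 1 by omega]; ring
    rw [h1] at hd
    by_contra h
    have h3 : (m + 2) * d ≤ 2 := by omega
    have := Nat.mul_le_mul_left (m + 1) h3
    omega
  have hne : ∀ a b : ℕ, 2 * r * d = a * b → (a : k) ≠ 0 := fun a b hab h =>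
    hchar (hab ▸ Dvd.dvd.mul_right ((ringChar.spec k a).1 h) b)
  have h2 : (2 : k) ≠ 0 := by
    simpa using hne 2 (r * d) (by ring)
  have hprime := CyclicCovers.prime_Phi (k := k) (n := n) (by omega) hN hn
    (hne r (2 * d) (by ring)) h2
  exact ⟨CyclicCovers.isIntegral_pullback_of_prime _ hprime, CyclicCovers.irreducible_Phi hprime⟩
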